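/- **Proposition 3.11.** Let $n$ be a positive integer. An *ordered factorization* of $n$ is a finite sequence $\mathbf d=(d_1,\dots,d_\ell)$ of integers $d_i\ge 2$ with $d_1\cdots d_\ell=n$. Two ordered factorizations $\mathbf d,\mathbf e$ of $n$ are *associated* if they have the same length and there is a permutation $\sigma$ of the indices with $d_i=e_{\sigma(i)}$ for all $i$ and $\sigma(i)<\sigma(j)$ whenever $i<j$ and $\gcd(d_i,d_j)>1$. For a field $F$ let $\mathcal P_n(F)$ be the set of monic $f\in F[x]$ of degree $n$ with $f(0)=0$. For a finite set $D$ of ordered factorizations of $n$ let $\mathcal D_{n,D}(F)$ be the set of all $f\in\mathcal P_n(F)$ such that for every $\mathbf d=(d_1,\dots,d_\ell)\in D$ there are $g_1,\dots,g_\ell\in F[x]$ with $\deg g_i=d_i$ for all $i$ and $f=g_1\circ\cdots\circ g_\ell$ (the empty composition being $x$). Algorithm 3.6 (refinement): given ordered factorizations $\mathbf d=(d_1,\dots,d_\ell)$ and $\mathbf e=(e_1,\dots,e_m)$ of $n$, for $i=1,\dots,\ell$ and, within this, for $j=1,\dots,m$, put $c_{i,j}=\gcd(d_i,e_j)$ and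 replace $d_i$ by $d_i/c_{i,j}$ and $e_j$ by $e_j/c_{i,j}$. Return the sequence $\mathbf d/\!/\mathbf e$, which is the matrix $(c_{i,j})$ read row by row with all entries $1$ omitted, and the sequence $\mathbf e/\!/\mathbf d$, which is the same matrix read column by column with all entries $1$ omitted. Let $D$ be a set of $c$ ordered factorizations of $n$. Then there is a set $D^*$ of at most $c$ ordered factorizations of $n$ such that (i) all elements of $D^*$ are pairwise associated; (ii) $\mathcal D_{n,D^*}(F)=\mathcal D_{n,D}(F)$ for every field $F$ whose characteristic does not divide $n$; (iii) $D^*$ can be computed from $D$ with $O(c^2)$ calls to Algorithm 3.6, where the implied constant is absolute. More precisely, (iii) holds in the following form: there are a constant $C$ and a computable function that maps each $c\ge 0$ to a list of at most $Cc^2$ pairs of positions such that, for every $n$, every $D$ with $c$ elements and every enumeration $(\mathbf d^{(1)},\dots,\mathbf d^{(c)})$ of $D$ without repetition, the following procedure ends with a sequence whose set of entries is a set $D^*$ as above: go through the list, and for each pair $(i,j)$ in it replace, with one call of Algorithm 3.6, the entries $\mathbf d,\mathbf e$ currently at positions $i,j$ by $\mathbf d/\!/\mathbf e$ and $\mathbf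 e/\!/\mathbf d$, respectively. -/

import Mathlib

namespace TameCollisions

/-- An ordered factorization `(d₁, …, d_ℓ)` of `n`: a finite sequence of integers greater than `1`
with product `n`. -/
def IsOrderedFactorization (n : ℕ) (d : List ℕ) : Prop :=
  d.prod = n ∧ ∀ a ∈ d, 1 < a

/-- `𝒫ₙ(F)`: the monic original (that is, `f(0) = 0`) polynomials of degree `n` over `F`. -/
def monicOriginal (F : Type*) [Field F] (n : ℕ) : Set (Polynomial F) :=
  {f | f.Monic ∧ f.natDegree = n ∧ f.eval 0 = 0}

/-- The composition `g₁ ∘ g₂ ∘ ⋯ ∘ g_ℓ` (the identity `x` for the empty sequence). -/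
noncomputable def compList {F : Type*} [Field F] (g : List (Polynomial F)) : Polynomial F :=
  g.foldr Polynomial.comp Polynomial.X

/-- `𝒟_{n,d}` for one sequence `d = (d₁, …, d_ℓ)`: the `f ∈ 𝒫ₙ(F)` of the form
`f = g₁ ∘ ⋯ ∘ g_ℓ` with `deg gᵢ = dᵢ` for all `i`. -/
def decomposables (F : Type*) [Field F] (n : ℕ) (d : List ℕ) : Set (Polynomial F) :=
  {f | f ∈ monicOriginal F n ∧
    ∃ g : List (Polynomial F), g.map Polynomial.natDegree = d ∧ f = compList g}

/-- `𝒟_{n,D}` for a finite set `D` of sequences: the `f ∈ 𝒫ₙ(F)` that lie in `𝒟_{n,d}` for all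
`d ∈ D`. -/
def collisions (F : Type*) [Field F] (n : ℕ) (D : Finset (List ℕ)) : Set (Polynomial F) :=
  {f | f ∈ monicOriginal F n ∧ ∀ d ∈ D, f ∈ decomposables F n d}

/-- `d` and `e` are associated: some bijection `σ` of the indices satisfies `dᵢ = e_{σ(i)}` for all
`i`, and `σ(i) < σ(j)` for all `i < j` with `gcd(dᵢ, dⱼ) > 1`.  (Entries of ordered factorizations
exceed `1`, so the last condition includes all `i < j` with `dᵢ = dⱼ`; hence `σ` is unique.) -/
def AreAssociated (d e : List ℕ) : Prop :=
  ∃ σ : Fin d.length ≃ Fin e.length,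
    (∀ i, d.get i = e.get (σ i)) ∧
    ∀ i j, i < j → 1 < Nat.gcd (d.get i) (d.get j) → σ i < σ j

/-- The inner loop of the refinement algorithm for one row.  `a` is the part of the row's entry not
yet split off, the list holds the parts of the column entries not yet split off.  From left to
right, `c = gcd(a, e)` is recorded and divided out of both `a` and `e`.
Returns the recorded row and the updated column entries. -/
def refineRow (a : ℕ) : List ℕ → List ℕ × List ℕ
  | [] => ([], [])
  | e :: es =>
    let c := Nat.gcd a e
    let r := refineRow (a / c) es
    (c :: r.1, (e / c) :: r.2)

/-- The outer loop of the refinement algorithm: the matrix `(c_{i,j})` of all recorded gcds, as the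
list of its rows. -/
def refineMatrix : List ℕ → List ℕ → List (List ℕ)
  | [], _ => []
  | d :: ds, es =>
    let r := refineRow d es
    r.1 :: refineMatrix ds r.2

/-- The refinement algorithm, on input `(d, e)`.  Its two outputs are the refinement of `d` by `e`
(the matrix `(c_{i,j})` read row by row, without the entries `1`) and the refinement of `e` by `d`
(the same matrix read column by column, without the entries `1`). -/
def refine (d e : List ℕ) : List ℕ × List ℕ :=
  let M := refineMatrix d e
  (M.flatten.filter (· ≠ 1), M.transpose.flatten.filter (· ≠ 1))

/-- One call of the refinement algorithm on a sequence of ordered factorizations: the entries `d`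
and `e` at the positions `p.1` and `p.2` (counted from `0`) are replaced by the refinement of `d`
by `e` and the refinement of `e` by `d`, respectively.  Nothing happens when a position does not
exist. -/
def callAt (s : List (List ℕ)) (p : ℕ × ℕ) : List (List ℕ) :=
  match s[p.1]?, s[p.2]? with
  | some d, some e => (s.set p.1 (refine d e).1).set p.2 (refine d e).2
  | _, _ => s

/-- Execute a list of calls of the refinement algorithm, one after the other.  The length of the
list `calls` is the number of calls. -/
def runCalls (calls : List (ℕ × ℕ)) (s : List (List ℕ)) : List (List ℕ) :=
  calls.foldl callAt s

end TameCollisions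

namespace TameCollisions

/-! ### Arithmetic of greatest common divisors -/

/-! An ordered factorization is encoded by the divisor chain of its prefix products. If `Dᵢ` and
`Eⱼ` are the prefix products of `d` and `e`, the refinement of `d` by `e` has the chain `lcm(Dᵢ,
gcd(Dᵢ₊₁, Eⱼ))` (`mem_prefixProds_refineMatrix_flatten`). This is the Schreier–Zassenhaus refinement
in the distributive lattice of divisors of `n`, and it is used in two ways.

Combinatorially, each prime power `q ∣ n` has a level in `d`: the index of the entry at which the
prefix products become divisible by `q`. Prime powers are join-prime, so two of them share a level
in the refinement exactly when they do so in both inputs; the level relations get intersected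
(`levelRel_refine_fst`). Equal level relations force association (`areAssociated_of_levelRel_eq`),
because the prime powers on a level determine the entry there.

For polynomials, `f` decomposes along `d` exactly when `n / k` is the degree of a right component of
`f` for every prefix product `k` (`mem_decomposables_iff_prefixProds`). In the tame case these
degrees are closed under gcd and lcm, so refining loses no polynomial. The closure is read off the
solutions `y_c / z` of `f(Y) = f(1 / z)`, labelled by the `n`-th roots of unity `c`. A right
component of degree `r` takes equal values at labels with equal `r`-th powers
(`isInvariant_of_eq_comp`), and conversely such an invariance of a polynomial of degree `r ∣ n`
makes it a right component (`IsInvariant.exists_eq_comp`). A polynomial gcd yields the degree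
`gcd(r₁, r₂)`, a resultant yields `r₁ r₂` for coprime degrees, and splitting off the gcd component
yields the lcm.

Finally, two sweeps of calls pairing position `0` with every other position suffice: the first
gathers the intersection of all level relations at position `0`, the second copies it everywhere. -/

theorem gcd_lcm_distrib_left {a b c : ℕ} (ha : a ≠ 0) (hb : b ≠ 0) (hc : c ≠ 0) :
    Nat.gcd a (Nat.lcm b c) = Nat.lcm (Nat.gcd a b) (Nat.gcd a c) := by
  have h1 : Nat.gcd a b ≠ 0 := Nat.gcd_ne_zero_left ha
  have h2 : Nat.gcd a c ≠ 0 := Nat.gcd_ne_zero_left ha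
  refine Nat.eq_of_factorization_eq (Nat.gcd_ne_zero_left ha) (Nat.lcm_ne_zero h1 h2) fun p => ?_
  rw [Nat.factorization_gcd ha (Nat.lcm_ne_zero hb hc), Nat.factorization_lcm hb hc,
    Nat.factorization_lcm h1 h2, Nat.factorization_gcd ha hb, Nat.factorization_gcd ha hc]
  simp only [Finsupp.inf_apply, Finsupp.sup_apply]
  exact inf_sup_left _ _ _

theorem gcd_mul_gcd_div_gcd {a : ℕ} (ha : 0 < a) (e P : ℕ) :
    Nat.gcd a e * Nat.gcd (a / Nat.gcd a e) P = Nat.gcd a (e * P) := by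
  have hc : 0 < Nat.gcd a e := Nat.gcd_pos_of_pos_left _ ha
  obtain ⟨a', ha'⟩ := Nat.gcd_dvd_left a e
  obtain ⟨e', he'⟩ := Nat.gcd_dvd_right a e
  have hcop := Nat.coprime_div_gcd_div_gcd hc
  generalize hg : Nat.gcd a e = c at *
  subst ha' he'
  rw [Nat.mul_div_cancel_left _ hc] at hcop ⊢
  rw [Nat.mul_div_cancel_left _ hc] at hcop
  rw [mul_assoc, Nat.gcd_mul_left, Nat.Coprime.gcd_mul_left_cancel_right _ hcop.symm]

/-- Distributivity together with `a * E' = lcm(a, E)`. This is the induction step that pulls the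
first entry `a` of `d` out of the refined chain. -/
theorem lcm_mul_gcd_mul {a D D' E E' : ℕ} (ha : 0 < a) (hD' : D' ≠ 0) (hE : E ≠ 0)
    (h : E' * Nat.gcd a E = E) :
    Nat.lcm (a * D) (Nat.gcd (a * D') E) = a * Nat.lcm D (Nat.gcd D' E') := by
  have h1 : a * E' = Nat.lcm a E := by
    apply Nat.eq_of_mul_eq_mul_left (Nat.gcd_pos_of_pos_left E ha)
    rw [Nat.gcd_mul_lcm]
    conv_rhs => rw [← h]
    ring
  rw [← Nat.lcm_mul_left, ← Nat.gcd_mul_left, h1,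
    gcd_lcm_distrib_left (mul_ne_zero ha.ne' hD') ha.ne' hE,
    Nat.gcd_eq_right (Dvd.intro _ rfl), ← Nat.lcm_assoc,
    Nat.lcm_eq_left (Dvd.intro _ rfl)]

/-- Prime powers are the join-irreducible divisors; this is why levels are taken of prime powers
only. -/
theorem dvd_lcm_iff_of_isPrimePow {q a b : ℕ} (hq : IsPrimePow q) (ha : a ≠ 0) (hb : b ≠ 0) :
    q ∣ Nat.lcm a b ↔ q ∣ a ∨ q ∣ b := by
  rw [isPrimePow_nat_iff] at hq
  obtain ⟨p, k, hp, -, rfl⟩ := hq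
  rw [hp.pow_dvd_iff_le_factorization (Nat.lcm_ne_zero ha hb), Nat.factorization_lcm ha hb,
    hp.pow_dvd_iff_le_factorization ha, hp.pow_dvd_iff_le_factorization hb, Finsupp.sup_apply]
  exact le_sup_iff

/-! ### Prefix products -/

/-- The products of the initial segments of a list. -/
def prefixProds (d : List ℕ) : Set ℕ := {k | ∃ i, (d.take i).prod = k}

theorem prefixProds_nil : prefixProds [] = {1} := by
  ext k; simp [prefixProds, eq_comm]

theorem mem_prefixProds_cons {a k : ℕ} {d : List ℕ} :
    k ∈ prefixProds (a :: d) ↔ k = 1 ∨ ∃ l ∈ prefixProds d, k = a * l := by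
  constructor
  · rintro ⟨_ | i, rfl⟩
    · simp
    · exact Or.inr ⟨_, ⟨i, rfl⟩, by simp⟩
  · rintro (rfl | ⟨_, ⟨i, rfl⟩, rfl⟩)
    · exact ⟨0, by simp⟩
    · exact ⟨i + 1, by simp⟩

theorem one_mem_prefixProds (d : List ℕ) : 1 ∈ prefixProds d := ⟨0, by simp⟩

theorem prefixProds_filter (d : List ℕ) : prefixProds (d.filter (· ≠ 1)) = prefixProds d := by
  induction d with
  | nil => rfl
  | cons a d ih =>
    by_cases h : a = 1
    · subst h
      ext k
      rw [List.filter_cons_of_neg (by simp), ih, mem_prefixProds_cons]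
      simp only [one_mul, exists_eq_right']
      constructor
      · exact Or.inr
      · rintro (rfl | h)
        exacts [one_mem_prefixProds d, h]
    · ext k
      rw [List.filter_cons_of_pos (by simpa using h), mem_prefixProds_cons, mem_prefixProds_cons, ih]

theorem prod_filter_ne_one (d : List ℕ) : (d.filter (· ≠ 1)).prod = d.prod := by
  induction d with
  | nil => rfl
  | cons a d ih =>
    by_cases h : a = 1
    · subst h; rw [List.filter_cons_of_neg (by simp), ih]; simp
    · rw [List.filter_cons_of_pos (by simpa using h), List.prod_cons, List.prod_cons, ih]

theorem mem_prefixProds_append {k : ℕ} {a b : List ℕ} :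
    k ∈ prefixProds (a ++ b) ↔ k ∈ prefixProds a ∨ ∃ l ∈ prefixProds b, k = a.prod * l := by
  induction a generalizing k with
  | nil =>
    simp only [List.nil_append, List.prod_nil, one_mul, exists_eq_right', prefixProds_nil,
      Set.mem_singleton_iff]
    constructor
    · exact Or.inr
    · rintro (rfl | h)
      exacts [one_mem_prefixProds b, h]
  | cons x a ih =>
    rw [List.cons_append, mem_prefixProds_cons, mem_prefixProds_cons, List.prod_cons]
    simp only [ih]
    constructor
    · rintro (h | ⟨l, h | ⟨m, hm, rfl⟩, rfl⟩)
      · exact Or.inl (Or.inl h)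
      · exact Or.inl (Or.inr ⟨l, h, rfl⟩)
      · exact Or.inr ⟨m, hm, by ring⟩
    · rintro ((h | ⟨l, h, rfl⟩) | ⟨m, hm, rfl⟩)
      · exact Or.inl h
      · exact Or.inr ⟨l, Or.inl h, rfl⟩
      · exact Or.inr ⟨_, Or.inr ⟨m, hm, rfl⟩, by ring⟩

theorem take_prod_dvd_take_prod (d : List ℕ) {i j : ℕ} (h : i ≤ j) :
    (d.take i).prod ∣ (d.take j).prod := by
  rw [← Nat.add_sub_cancel' h, List.take_add, List.prod_append]
  exact Dvd.intro _ rfl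

theorem take_prod_dvd_prod (d : List ℕ) (i : ℕ) : (d.take i).prod ∣ d.prod := by
  conv_rhs => rw [← List.take_append_drop i d, List.prod_append]
  exact Dvd.intro _ rfl

/-! ### The refinement matrix -/

theorem refineRow_length_fst (a : ℕ) (es : List ℕ) : (refineRow a es).1.length = es.length := by
  induction es generalizing a with
  | nil => rfl
  | cons e es ih => simp [refineRow, ih]

/-- The recorded gcds telescope: once `gcd(a, e)` is divided out, the rest of `a` is coprime to the
rest of `e`, so `e` can be put back into later gcds. -/
theorem refineRow_fst_take_prod {a : ℕ} (ha : 0 < a) (es : List ℕ) (j : ℕ) :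
    ((refineRow a es).1.take j).prod = Nat.gcd a (es.take j).prod := by
  induction es generalizing a j with
  | nil => simp [refineRow]
  | cons e es ih =>
    cases j with
    | zero => simp
    | succ j =>
      have hc : 0 < a / Nat.gcd a e :=
        Nat.div_pos (Nat.gcd_le_left _ ha) (Nat.gcd_pos_of_pos_left _ ha)
      simp only [refineRow, List.take_succ_cons, List.prod_cons, ih hc]
      exact gcd_mul_gcd_div_gcd ha _ _

theorem refineRow_snd_take_prod {a : ℕ} (ha : 0 < a) (es : List ℕ) (j : ℕ) :
    ((refineRow a es).2.take j).prod * Nat.gcd a (es.take j).prod = (es.take j).prod := by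
  induction es generalizing a j with
  | nil => simp [refineRow]
  | cons e es ih =>
    cases j with
    | zero => simp
    | succ j =>
      have hc : 0 < a / Nat.gcd a e :=
        Nat.div_pos (Nat.gcd_le_left _ ha) (Nat.gcd_pos_of_pos_left _ ha)
      simp only [refineRow, List.take_succ_cons, List.prod_cons]
      rw [← gcd_mul_gcd_div_gcd ha, ← ih hc j]
      rw [mul_mul_mul_comm, Nat.div_mul_cancel (Nat.gcd_dvd_right _ _), ih hc j, ih hc j]

theorem refineRow_fst_prod {a : ℕ} (ha : 0 < a) (es : List ℕ) :
    (refineRow a es).1.prod = Nat.gcd a es.prod := by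
  have h := refineRow_fst_take_prod ha es es.length
  rwa [List.take_length, ← refineRow_length_fst a es, List.take_length] at h

theorem refineRow_length_snd (a : ℕ) (es : List ℕ) : (refineRow a es).2.length = es.length := by
  induction es generalizing a with
  | nil => rfl
  | cons e es ih => simp [refineRow, ih]

theorem refineRow_snd_prod {a : ℕ} (ha : 0 < a) (es : List ℕ) :
    (refineRow a es).2.prod * Nat.gcd a es.prod = es.prod := by
  have h := refineRow_snd_take_prod ha es es.length
  rwa [List.take_length, ← refineRow_length_snd a es, List.take_length] at h

theorem refineRow_snd_prod_of_mul {a m : ℕ} (ha : 0 < a) {es : List ℕ} (h : a * m = es.prod) :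
    (refineRow a es).2.prod = m := by
  have h2 := refineRow_snd_prod ha es
  rw [← h, Nat.gcd_eq_left (Dvd.intro _ rfl), mul_comm a m] at h2
  exact Nat.eq_of_mul_eq_mul_right ha h2

theorem refineMatrix_flatten_prod {d e : List ℕ} (hd : ∀ a ∈ d, 0 < a) (h : d.prod = e.prod) :
    (refineMatrix d e).flatten.prod = d.prod := by
  induction d generalizing e with
  | nil => simp [refineMatrix]
  | cons a d ih =>
    have ha := hd a (by simp)
    rw [List.prod_cons] at h
    have h2 := refineRow_snd_prod_of_mul ha h
    simp only [refineMatrix, List.flatten_cons, List.prod_append, List.prod_cons]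
    rw [ih (fun b hb => hd b (by simp [hb])) h2.symm, refineRow_fst_prod ha, ← h,
      Nat.gcd_eq_left (Dvd.intro _ rfl)]

/-- Row `i` interpolates between two consecutive prefix products of `d` by means of the chain of
`e`. After the first row the columns multiply up to `Eⱼ / gcd(a, Eⱼ)`, which is what
`lcm_mul_gcd_mul` needs to pass to the tail. -/
theorem mem_prefixProds_refineMatrix_flatten {d e : List ℕ} (hd : ∀ a ∈ d, 0 < a)
    (h : d.prod = e.prod) {k : ℕ} :
    k ∈ prefixProds (refineMatrix d e).flatten ↔
      ∃ i j, k = Nat.lcm (d.take i).prod (Nat.gcd (d.take (i + 1)).prod (e.take j).prod) := by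
  induction d generalizing e k with
  | nil => simp [refineMatrix, prefixProds_nil]
  | cons a d ih =>
    have ha := hd a (by simp)
    have hd' : ∀ b ∈ d, 0 < b := fun b hb => hd b (by simp [hb])
    have hdp : d.prod ≠ 0 := List.prod_ne_zero fun h0 => (hd' 0 h0).ne' rfl
    rw [List.prod_cons] at h
    have hep : e.prod ≠ 0 := h ▸ mul_ne_zero ha.ne' hdp
    have h2 := refineRow_snd_prod_of_mul ha h
    have key : ∀ i j, Nat.lcm (a * (d.take i).prod)
        (Nat.gcd (a * (d.take (i + 1)).prod) (e.take j).prod) =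
        a * Nat.lcm (d.take i).prod
          (Nat.gcd (d.take (i + 1)).prod ((refineRow a e).2.take j).prod) := fun i j =>
      lcm_mul_gcd_mul ha (ne_zero_of_dvd_ne_zero hdp (take_prod_dvd_prod _ _))
        (ne_zero_of_dvd_ne_zero hep (take_prod_dvd_prod _ _)) (refineRow_snd_take_prod ha e j)
    simp only [refineMatrix, List.flatten_cons]
    rw [mem_prefixProds_append, refineRow_fst_prod ha, ← h, Nat.gcd_eq_left (Dvd.intro _ rfl)]
    simp only [ih hd' h2.symm]
    constructor
    · rintro (⟨j, rfl⟩ | ⟨_, ⟨i, j, rfl⟩, rfl⟩)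
      · exact ⟨0, j, by simp [refineRow_fst_take_prod ha]⟩
      · exact ⟨i + 1, j, by simp [← key]⟩
    · rintro ⟨_ | i, j, rfl⟩
      · exact Or.inl ⟨j, by simp [refineRow_fst_take_prod ha]⟩
      · exact Or.inr ⟨_, ⟨i, j, rfl⟩, by simp [← key]⟩

/-! ### Transposition -/

/-- Entry `(i, j)` depends only on what is left of `dᵢ` after the earlier columns and of `eⱼ` after
the earlier rows, so the matrix can be filled column by column as well. -/
theorem refineMatrix_cons_right (ds : List ℕ) (e : ℕ) (es : List ℕ) :
    refineMatrix ds (e :: es) =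
      List.zipWith List.cons (refineRow e ds).1 (refineMatrix (refineRow e ds).2 es) := by
  induction ds generalizing e es with
  | nil => simp [refineMatrix, refineRow]
  | cons d ds ih =>
    simp only [refineMatrix, refineRow, List.zipWith_cons_cons, ih, Nat.gcd_comm e d]

theorem refineMatrix_length (d e : List ℕ) : (refineMatrix d e).length = d.length := by
  induction d generalizing e with
  | nil => rfl
  | cons a d ih => simp [refineMatrix, ih]

/-- Unfolds the state monad inside `List.transpose`: each accumulated column takes one element off
the row held as state. -/
theorem mapM_transpose_pop {α : Type*} (acc : List (List α)) (l : List α)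
    (h : l.length = acc.length) :
    (acc.mapM List.transpose.pop : StateM (List α) (List (List α))) l =
      (List.zipWith List.cons l acc, []) := by
  induction acc generalizing l with
  | nil =>
    rw [List.length_nil, List.length_eq_zero_iff] at h
    subst h; rfl
  | cons b acc ih =>
    cases l with
    | nil => simp at h
    | cons a l =>
      rw [List.mapM_cons]
      have := ih l (by simpa using h)
      simp only [bind, StateT.bind, List.transpose.pop, List.zipWith_cons_cons]
      rw [this]
      rfl

theorem transpose_go {α : Type*} (acc : Array (List α)) (l : List α)
    (h : l.length = acc.size) :
    (List.transpose.go l acc).toList = List.zipWith List.cons l acc.toList := by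
  have h1 : (acc.mapM List.transpose.pop : StateM (List α) (Array (List α))) l =
      ((List.zipWith List.cons l acc.toList).toArray, []) := by
    rw [Array.mapM_eq_mapM_toList]
    simp only [Functor.map, StateT.map, bind]
    rw [mapM_transpose_pop _ _ (by simpa using h)]
    rfl
  unfold List.transpose.go
  rw [h1]
  simp

theorem transpose_cons {α : Type*} (l : List α) (L : List (List α))
    (h : l.length = L.transpose.length) :
    (l :: L).transpose = List.zipWith List.cons l L.transpose := by
  unfold List.transpose at *
  rw [List.foldr_cons]
  exact transpose_go _ _ (by simpa using h)

theorem transpose_singleton {α : Type*} (l : List α) : [l].transpose = l.map fun a => [a] := by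
  have h1 : (Array.mapM List.transpose.pop #[] : StateM (List α) (Array (List α))) l = (#[], l) := by
    rw [Array.mapM_empty]; rfl
  unfold List.transpose
  rw [List.foldr_cons, List.foldr_nil]
  unfold List.transpose.go
  rw [h1]
  simp

theorem refineMatrix_nil_right (es : List ℕ) : refineMatrix es [] = es.map fun _ => [] := by
  induction es with
  | nil => rfl
  | cons e es ih => simp [refineMatrix, refineRow, ih]

/-- The case `d = []` fails for nonempty `e`: the transpose of no rows is empty, whereas the right
side consists of empty rows. -/
theorem transpose_refineMatrix {d : List ℕ} (hd : d ≠ []) (e : List ℕ) :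
    (refineMatrix d e).transpose = refineMatrix e d := by
  induction d generalizing e with
  | nil => exact absurd rfl hd
  | cons a d ih =>
    rw [refineMatrix_cons_right]
    by_cases h : d = []
    · subst h
      have : ∀ l m : List ℕ, l.length = m.length →
          l.map (fun a => [a]) = List.zipWith List.cons l (m.map fun _ => []) := by
        intro l
        induction l with
        | nil => simp
        | cons x l ih =>
          rintro (_ | ⟨y, m⟩) hm
          · simp at hm
          · simpa using ih m (by simpa using hm)
      rw [refineMatrix_nil_right]
      simp only [refineMatrix, transpose_singleton]
      exact this _ _ (by rw [refineRow_length_fst, refineRow_length_snd])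
    · simp only [refineMatrix]
      rw [transpose_cons _ _ (by
        rw [ih h, refineMatrix_length, refineRow_length_fst, refineRow_length_snd]), ih h]

/-! ### Refinement of ordered factorizations -/

theorem refine_snd {n : ℕ} {d e : List ℕ} (hd : IsOrderedFactorization n d)
    (he : IsOrderedFactorization n e) : (refine d e).2 = (refine e d).1 := by
  by_cases h : d = []
  · subst h
    have h1 : e = [] := by
      cases e with
      | nil => rfl
      | cons a e =>
        have h2 : a * e.prod = 1 := by rw [← List.prod_cons, he.1, ← hd.1]; rfl
        have h3 := he.2 a (by simp)
        have := Nat.eq_one_of_mul_eq_one_right h2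
        omega
    subst h1
    rfl
  · simp only [refine, transpose_refineMatrix h]

theorem IsOrderedFactorization.pos {n : ℕ} {d : List ℕ} (hd : IsOrderedFactorization n d) :
    ∀ a ∈ d, 0 < a := fun a ha => (Nat.zero_lt_one.trans (hd.2 a ha))

theorem IsOrderedFactorization.refine_fst {n : ℕ} (hn : 0 < n) {d e : List ℕ}
    (hd : IsOrderedFactorization n d) (he : IsOrderedFactorization n e) :
    IsOrderedFactorization n (refine d e).1 := by
  have h1 := refineMatrix_flatten_prod hd.pos (hd.1.trans he.1.symm)
  refine ⟨(prod_filter_ne_one _).trans (h1.trans hd.1), fun a ha => ?_⟩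
  have ha := List.mem_filter.1 ha
  have h3 : a ≠ 0 := by
    rintro rfl
    exact hn.ne' (hd.1 ▸ h1 ▸ List.prod_eq_zero ha.1)
  have h4 : a ≠ 1 := by simpa using ha.2
  omega

theorem mem_prefixProds_refine_fst {n : ℕ} {d e : List ℕ}
    (hd : IsOrderedFactorization n d) (he : IsOrderedFactorization n e) {k : ℕ} :
    k ∈ prefixProds (refine d e).1 ↔
      ∃ i j, k = Nat.lcm (d.take i).prod (Nat.gcd (d.take (i + 1)).prod (e.take j).prod) := by
  rw [← mem_prefixProds_refineMatrix_flatten hd.pos (hd.1.trans he.1.symm)]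
  simp only [refine, prefixProds_filter]

end TameCollisions

namespace TameCollisions

/-! ### Levels of prime powers -/

/-- The position of the entry of `d` that completes the divisor `q` of `d.prod`. -/
noncomputable def level (d : List ℕ) (q : ℕ) : ℕ := sInf {i | q ∣ (d.take (i + 1)).prod}

/-- The prefix products form a divisor chain, so divisibility by `q` has a threshold. The hypotheses
exclude the empty prefix and the default value of `sInf` on the empty set. -/
theorem dvd_take_prod_iff {d : List ℕ} {q : ℕ} (hq : q ≠ 1) (hd : q ∣ d.prod) (k : ℕ) :
    q ∣ (d.take k).prod ↔ level d q < k := by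
  have hne : {i | q ∣ (d.take (i + 1)).prod}.Nonempty :=
    ⟨d.length, by simpa [List.take_of_length_le] using hd⟩
  constructor
  · intro h
    cases k with
    | zero => exact absurd (Nat.dvd_one.1 (by simpa using h)) hq
    | succ k => exact Nat.lt_succ_of_le (Nat.sInf_le h)
  · intro h
    exact (Nat.sInf_mem hne).trans (take_prod_dvd_take_prod d h)

theorem level_lt_length {d : List ℕ} {q : ℕ} (hq : q ≠ 1) (hd : q ∣ d.prod) :
    level d q < d.length := by
  rw [← dvd_take_prod_iff hq hd, List.take_length]
  exact hd

/-- Two divisors have the same level. -/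
def SameLevel (d : List ℕ) (q q' : ℕ) : Prop := ∀ k ∈ prefixProds d, q ∣ k ↔ q' ∣ k

theorem sameLevel_iff {d : List ℕ} {q q' : ℕ} (hq : q ≠ 1) (hq' : q' ≠ 1) (hd : q ∣ d.prod)
    (hd' : q' ∣ d.prod) : SameLevel d q q' ↔ level d q = level d q' := by
  constructor
  · intro h
    apply le_antisymm
    · have := (h _ ⟨level d q' + 1, rfl⟩).2 ((dvd_take_prod_iff hq' hd' _).2 (Nat.lt_succ_self _))
      rw [dvd_take_prod_iff hq hd] at this
      omega
    · have := (h _ ⟨level d q + 1, rfl⟩).1 ((dvd_take_prod_iff hq hd _).2 (Nat.lt_succ_self _))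
      rw [dvd_take_prod_iff hq' hd'] at this
      omega
  · rintro h _ ⟨k, rfl⟩
    rw [dvd_take_prod_iff hq hd, dvd_take_prod_iff hq' hd', h]

theorem prefixProds_ne_zero {d : List ℕ} (hd : d.prod ≠ 0) {k : ℕ} (hk : k ∈ prefixProds d) :
    k ≠ 0 := by
  obtain ⟨i, rfl⟩ := hk
  exact ne_zero_of_dvd_ne_zero hd (take_prod_dvd_prod _ _)

theorem sameLevel_refine_fst {n : ℕ} (hn : 0 < n) {d e : List ℕ} {q q' : ℕ}
    (hd : IsOrderedFactorization n d) (he : IsOrderedFactorization n e) (hq : IsPrimePow q)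
    (hq' : IsPrimePow q') (hqn : q ∣ n) (hqn' : q' ∣ n) :
    SameLevel (refine d e).1 q q' ↔ SameLevel d q q' ∧ SameLevel e q q' := by
  have hD : ∀ i, (d.take i).prod ≠ 0 := fun i =>
    prefixProds_ne_zero (hd.1.trans_ne hn.ne') ⟨i, rfl⟩
  have key : ∀ q, IsPrimePow q → ∀ i j,
      (q ∣ Nat.lcm (d.take i).prod (Nat.gcd (d.take (i + 1)).prod (e.take j).prod) ↔
        q ∣ (d.take i).prod ∨ q ∣ (d.take (i + 1)).prod ∧ q ∣ (e.take j).prod) := by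
    intro q hq i j
    rw [dvd_lcm_iff_of_isPrimePow hq (hD i) (Nat.gcd_ne_zero_left (hD _)), Nat.dvd_gcd_iff]
  constructor
  · intro h
    have h1 : SameLevel d q q' := by
      rintro _ ⟨i, rfl⟩
      -- With `j = 0` the inner gcd is `1`, which leaves the prefix product of `d` itself.
      refine h _ ((mem_prefixProds_refine_fst hd he).2 ⟨i, 0, ?_⟩)
      simp
    refine ⟨h1, ?_⟩
    rw [sameLevel_iff hq.ne_one hq'.ne_one (hd.1 ▸ hqn) (hd.1 ▸ hqn')] at h1
    rintro _ ⟨j, rfl⟩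
    -- At the common level `i` in `d`, neither `q` nor `q'` divides `Dᵢ` and both divide `Dᵢ₊₁`, so
    -- divisibility of the refined product reduces to that of `Eⱼ`.
    have h2 := h _ ((mem_prefixProds_refine_fst hd he).2 ⟨level d q, j, rfl⟩)
    rw [key q hq, key q' hq'] at h2
    simp only [dvd_take_prod_iff hq.ne_one (hd.1 ▸ hqn), h1,
      dvd_take_prod_iff hq'.ne_one (hd.1 ▸ hqn'), lt_irrefl, false_or, Nat.lt_succ_self,
      true_and] at h2
    exact h2
  · rintro ⟨h1, h2⟩ k hk
    obtain ⟨i, j, rfl⟩ := (mem_prefixProds_refine_fst hd he).1 hk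
    rw [key q hq, key q' hq', h1 _ ⟨i, rfl⟩, h1 _ ⟨i + 1, rfl⟩, h2 _ ⟨j, rfl⟩]

/-- The prime powers dividing `n` that have the same level in `d`, as a relation. -/
def levelRel (n : ℕ) (d : List ℕ) : Set (ℕ × ℕ) :=
  {p | (IsPrimePow p.1 ∧ p.1 ∣ n) ∧ (IsPrimePow p.2 ∧ p.2 ∣ n) ∧ SameLevel d p.1 p.2}

theorem levelRel_refine_fst {n : ℕ} (hn : 0 < n) {d e : List ℕ}
    (hd : IsOrderedFactorization n d) (he : IsOrderedFactorization n e) :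
    levelRel n (refine d e).1 = levelRel n d ∩ levelRel n e := by
  ext ⟨q, q'⟩
  simp only [levelRel, Set.mem_ofPred_eq, Set.mem_inter_iff]
  constructor
  · rintro ⟨h, h', h2⟩
    rw [sameLevel_refine_fst hn hd he h.1 h'.1 h.2 h'.2] at h2
    exact ⟨⟨h, h', h2.1⟩, h, h', h2.2⟩
  · rintro ⟨⟨h, h', h1⟩, -, -, h2⟩
    exact ⟨h, h', (sameLevel_refine_fst hn hd he h.1 h'.1 h.2 h'.2).2 ⟨h1, h2⟩⟩

theorem take_succ_prod_get (d : List ℕ) (i : Fin d.length) :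
    (d.take (i + 1)).prod = (d.take i).prod * d.get i := by
  rw [List.prod_take_succ _ _ i.2]; rfl

theorem get_ne_zero {n : ℕ} {d : List ℕ} (hd : IsOrderedFactorization n d) (i : Fin d.length) :
    d.get i ≠ 0 := (hd.pos _ (d.get_mem i)).ne'

/-- The least power of a prime `p` not dividing the product of the entries of `d` before the
`i`-th one has level `i`, when `p` divides the `i`-th entry. -/
theorem level_pow_factorization {n : ℕ} (hn : 0 < n) {d : List ℕ}
    (hd : IsOrderedFactorization n d) (i : Fin d.length) {p : ℕ} (hp : p.Prime)
    (hpi : p ∣ d.get i) :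
    p ^ ((d.take i).prod.factorization p + 1) ∣ n ∧
      level d (p ^ ((d.take i).prod.factorization p + 1)) = i := by
  have h0 : (d.take i).prod ≠ 0 := prefixProds_ne_zero (hd.1.trans_ne hn.ne') ⟨i, rfl⟩
  have h1 : ¬ p ^ ((d.take i).prod.factorization p + 1) ∣ (d.take i).prod :=
    Nat.pow_succ_factorization_not_dvd h0 hp
  have h2 : p ^ ((d.take i).prod.factorization p + 1) ∣ (d.take (i + 1)).prod := by
    rw [take_succ_prod_get, pow_succ]
    exact mul_dvd_mul (Nat.ordProj_dvd _ _) hpi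
  have h3 := h2.trans (take_prod_dvd_prod d _)
  have hne : p ^ ((d.take i).prod.factorization p + 1) ≠ 1 :=
    (hp.isPrimePow.pow (Nat.succ_ne_zero _)).ne_one
  refine ⟨hd.1 ▸ h3, ?_⟩
  rw [dvd_take_prod_iff hne h3] at h1 h2
  omega

/-- Every index is a level, so the classes of the level relation correspond to the indices. -/
theorem exists_isPrimePow_level {n : ℕ} (hn : 0 < n) {d : List ℕ}
    (hd : IsOrderedFactorization n d) (i : Fin d.length) :
    ∃ q, IsPrimePow q ∧ q ∣ n ∧ level d q = i := by
  obtain ⟨p, hp, hpi⟩ := Nat.exists_prime_and_dvd (hd.2 _ (d.get_mem i)).ne'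
  obtain ⟨h1, h2⟩ := level_pow_factorization hn hd i hp hpi
  exact ⟨_, hp.isPrimePow.pow (Nat.succ_ne_zero _), h1, h2⟩

-- The identity `log m = ∑ Λ(q)` over `q ∣ m`, applied to two consecutive prefix products and
-- subtracted. It shows that an entry is determined by the prime powers on its level.
open ArithmeticFunction in
theorem log_get {n : ℕ} (hn : 0 < n) {d : List ℕ} (hd : IsOrderedFactorization n d)
    (i : Fin d.length) :
    Real.log (d.get i) =
      ∑ q ∈ n.divisors.filter (fun q => IsPrimePow q ∧ level d q = i), vonMangoldt q := by
  have hD : ∀ i, (d.take i).prod ≠ 0 := fun i =>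
    prefixProds_ne_zero (hd.1.trans_ne hn.ne') ⟨i, rfl⟩
  have hlog : ∀ k, Real.log (d.take k).prod =
      ∑ q ∈ n.divisors.filter (fun q => IsPrimePow q ∧ level d q < k), vonMangoldt q := by
    intro k
    rw [← vonMangoldt_sum]
    symm
    apply Finset.sum_subset_zero_on_sdiff
    · intro q hq
      simp only [Finset.mem_filter, Nat.mem_divisors] at hq
      exact Nat.mem_divisors.2
        ⟨(dvd_take_prod_iff hq.2.1.ne_one (hd.1 ▸ hq.1.1) k).2 hq.2.2, hD k⟩
    · intro q hq
      simp only [Finset.mem_sdiff, Finset.mem_filter, Nat.mem_divisors, not_and] at hq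
      rw [vonMangoldt_eq_zero_iff]
      intro hpp
      have h1 : q ∣ n := hd.1 ▸ hq.1.1.trans (take_prod_dvd_prod d k)
      exact hq.2 ⟨h1, hn.ne'⟩ hpp
        ((dvd_take_prod_iff hpp.ne_one (hd.1 ▸ h1) k).1 hq.1.1)
    · intros; rfl
  have h1 := hlog (i + 1)
  rw [take_succ_prod_get, Nat.cast_mul, Real.log_mul (by exact_mod_cast hD i)
    (by exact_mod_cast get_ne_zero hd i), hlog i] at h1
  rw [← add_right_inj, h1, ← Finset.sum_union]
  · congr 1
    ext q
    simp only [Finset.mem_union, Finset.mem_filter, Nat.lt_succ_iff_lt_or_eq]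
    tauto
  · rw [Finset.disjoint_filter]
    intro q _ h h'
    omega

/-- The bijection sends the level of a prime power in `d` to its level in `e`. This is well defined
and invertible because both sequences have the same level classes. -/
theorem areAssociated_of_levelRel_eq {n : ℕ} (hn : 0 < n) {d e : List ℕ}
    (hd : IsOrderedFactorization n d) (he : IsOrderedFactorization n e)
    (h : levelRel n d = levelRel n e) : AreAssociated d e := by
  have hlev : ∀ q q', IsPrimePow q → IsPrimePow q' → q ∣ n → q' ∣ n →
      (level d q = level d q' ↔ level e q = level e q') := by
    intro q q' hq hq' hqn hqn'
    rw [← sameLevel_iff hq.ne_one hq'.ne_one (hd.1 ▸ hqn) (hd.1 ▸ hqn'),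
      ← sameLevel_iff hq.ne_one hq'.ne_one (he.1 ▸ hqn) (he.1 ▸ hqn')]
    have := Set.ext_iff.1 h (q, q')
    simpa [levelRel, hq, hq', hqn, hqn'] using this
  choose qd hqd1 hqd2 hqd3 using exists_isPrimePow_level hn hd
  choose qe hqe1 hqe2 hqe3 using exists_isPrimePow_level hn he
  let σ : Fin d.length ≃ Fin e.length :=
    { toFun := fun i => ⟨level e (qd i), level_lt_length (hqd1 i).ne_one (he.1 ▸ hqd2 i)⟩
      invFun := fun j => ⟨level d (qe j), level_lt_length (hqe1 j).ne_one (hd.1 ▸ hqe2 j)⟩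
      left_inv := by
        intro i
        ext
        rw [Fin.val_mk, ← hqd3 i, hlev _ _ (hqe1 _) (hqd1 _) (hqe2 _) (hqd2 _), hqe3]
      right_inv := by
        intro j
        ext
        rw [Fin.val_mk, ← hqe3 j, ← hlev _ _ (hqd1 _) (hqe1 _) (hqd2 _) (hqe2 _), hqd3] }
  have hσ : ∀ (i : Fin d.length) q, IsPrimePow q → q ∣ n → (level d q = i ↔ level e q = σ i) := by
    intro i q hq hqn
    rw [← hqd3 i, hlev _ _ hq (hqd1 i) hqn (hqd2 i)]
    rfl
  refine ⟨σ, fun i => ?_, fun i j hij hg => ?_⟩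
  · have h1 := log_get hn hd i
    have h2 := log_get hn he (σ i)
    have h3 : Real.log (d.get i) = Real.log (e.get (σ i)) := by
      rw [h1, h2]
      congr 1
      apply Finset.filter_congr
      intro q hq
      have := fun hpp => hσ i q hpp (Nat.dvd_of_mem_divisors hq)
      tauto
    have h4 := Real.log_injOn_pos
      (Set.mem_Ioi.2 (by exact_mod_cast Nat.pos_of_ne_zero (get_ne_zero hd i)))
      (Set.mem_Ioi.2 (by exact_mod_cast Nat.pos_of_ne_zero (get_ne_zero he (σ i)))) h3
    exact_mod_cast h4
  · obtain ⟨p, hp, hpg⟩ := Nat.exists_prime_and_dvd hg.ne'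
    obtain ⟨hi1, hi2⟩ := level_pow_factorization hn hd i hp (hpg.trans (Nat.gcd_dvd_left _ _))
    obtain ⟨hj1, hj2⟩ := level_pow_factorization hn hd j hp (hpg.trans (Nat.gcd_dvd_right _ _))
    have hpi := hp.isPrimePow.pow (k := (d.take i).prod.factorization p + 1) (Nat.succ_ne_zero _)
    have hpj := hp.isPrimePow.pow (k := (d.take j).prod.factorization p + 1) (Nat.succ_ne_zero _)
    -- The witnesses for levels `i < j` are powers of the same prime, one dividing the other; a
    -- divisor never has the higher level, in `e` as in `d`.
    have hdvd : p ^ ((d.take i).prod.factorization p + 1) ∣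
        p ^ ((d.take j).prod.factorization p + 1) := by
      apply pow_dvd_pow
      have := (Nat.factorization_le_iff_dvd
        (prefixProds_ne_zero (hd.1.trans_ne hn.ne') ⟨i, rfl⟩)
        (prefixProds_ne_zero (hd.1.trans_ne hn.ne') ⟨j, rfl⟩)).2
        (take_prod_dvd_take_prod d (Fin.val_fin_le.2 hij.le)) p
      omega
    rw [hσ i _ hpi hi1] at hi2
    rw [hσ j _ hpj hj1] at hj2
    refine lt_of_le_of_ne ?_ (σ.injective.ne hij.ne)
    rw [← Fin.val_fin_le, ← hi2, ← hj2, ← Nat.lt_succ_iff,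
      ← dvd_take_prod_iff hpi.ne_one (he.1 ▸ hi1)]
    exact hdvd.trans ((dvd_take_prod_iff hpj.ne_one (he.1 ▸ hj1) _).2 (Nat.lt_succ_self _))

end TameCollisions

namespace TameCollisions

open Polynomial

/-! ### Polynomials at points with a simple pole -/

section Puiseux

variable {F K : Type*} [Field F] [Field K] [Algebra F K]

/-- The point `v / z`, where `z` is the power series variable. -/
noncomputable def polePoint (v : PowerSeries K) : FractionRing (PowerSeries K) :=
  (algebraMap _ _ (PowerSeries.X : PowerSeries K))⁻¹ * algebraMap _ _ v

/-- The inclusion of `F` into the field of Laurent series over `K`. -/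
noncomputable def laurentC (F K : Type*) [Field F] [Field K] [Algebra F K] :
    F →+* FractionRing (PowerSeries K) :=
  (algebraMap (PowerSeries K) (FractionRing (PowerSeries K))).comp
    (PowerSeries.C.comp (algebraMap F K))

/-- Evaluation of polynomials over `F` at the point `v / z`. -/
noncomputable def evalPole (v : PowerSeries K) : F[X] →+* FractionRing (PowerSeries K) :=
  eval₂RingHom (laurentC F K) (polePoint v)

theorem algebraMap_powerSeries_injective :
    Function.Injective (algebraMap (PowerSeries K) (FractionRing (PowerSeries K))) :=
  IsFractionRing.injective _ _

theorem algebraMap_X_ne_zero :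
    algebraMap (PowerSeries K) (FractionRing (PowerSeries K)) PowerSeries.X ≠ 0 := by
  rw [Ne, map_eq_zero_iff _ algebraMap_powerSeries_injective]
  exact PowerSeries.X_ne_zero

theorem X_mul_polePoint (v : PowerSeries K) :
    algebraMap _ _ (PowerSeries.X : PowerSeries K) * polePoint v = algebraMap _ _ v := by
  rw [polePoint, mul_inv_cancel_left₀ algebraMap_X_ne_zero]

theorem polePoint_injective : Function.Injective (polePoint (K := K)) := by
  intro v w h
  apply algebraMap_powerSeries_injective
  rw [← X_mul_polePoint v, ← X_mul_polePoint w, h]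

theorem evalPole_C (v : PowerSeries K) (a : F) : evalPole v (C a) = laurentC F K a := by
  simp [evalPole]

theorem evalPole_comp (v : PowerSeries K) (p q : F[X]) :
    evalPole v (p.comp q) = p.eval₂ (laurentC F K) (evalPole v q) := by
  simp only [evalPole, coe_eval₂RingHom]
  exact eval₂_comp _

/-- The polynomial `z ^ deg p * p (X / z)` with power series coefficients. -/
noncomputable def poleScale (K : Type*) [Field K] [Algebra F K] (p : F[X]) : (PowerSeries K)[X] :=
  (p.map (PowerSeries.C.comp (algebraMap F K))).scaleRoots PowerSeries.X

theorem poleScale_natDegree (p : F[X]) : (poleScale K p).natDegree = p.natDegree := by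
  rw [poleScale, natDegree_scaleRoots, natDegree_map]

theorem algebraMap_eval_poleScale (p : F[X]) (v : PowerSeries K) :
    algebraMap _ _ ((poleScale K p).eval v) =
      (algebraMap _ _ (PowerSeries.X : PowerSeries K)) ^ p.natDegree * evalPole v p := by
  have h := scaleRoots_eval₂_mul (p := p.map (PowerSeries.C.comp (algebraMap F K)))
    (algebraMap (PowerSeries K) (FractionRing (PowerSeries K))) (polePoint v) PowerSeries.X
  rw [X_mul_polePoint, natDegree_map, eval₂_map] at h
  rw [← eval₂_at_apply]
  exact h

/-- Setting `z = 0` leaves only the leading term. -/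
theorem map_poleScale (p : F[X]) :
    (poleScale K p).map PowerSeries.constantCoeff =
      C (algebraMap F K p.leadingCoeff) * X ^ p.natDegree := by
  by_cases hp : p = 0
  · simp [hp, poleScale]
  have h : (PowerSeries.constantCoeff (R := K)).comp (PowerSeries.C.comp (algebraMap F K)) =
      algebraMap F K := by ext; simp
  rw [poleScale, map_scaleRoots, map_map, h, PowerSeries.constantCoeff_X, scaleRoots_zero,
    natDegree_map, leadingCoeff_map, smul_eq_C_mul]
  simpa using hp

theorem constantCoeff_eval_poleScale (p : F[X]) (v : PowerSeries K) :
    PowerSeries.constantCoeff ((poleScale K p).eval v) =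
      algebraMap F K p.leadingCoeff * PowerSeries.constantCoeff v ^ p.natDegree := by
  rw [← eval₂_at_apply, ← eval_map, map_poleScale]
  simp

theorem constantCoeff_eval_derivative_poleScale (p : F[X]) (v : PowerSeries K) :
    PowerSeries.constantCoeff ((derivative (poleScale K p)).eval v) =
      algebraMap F K p.leadingCoeff * p.natDegree *
        PowerSeries.constantCoeff v ^ (p.natDegree - 1) := by
  rw [← eval₂_at_apply, ← eval_map, ← derivative_map, map_poleScale]
  rw [derivative_C_mul_X_pow]
  simp

/-- A point with a genuine pole is transcendental over `F`: the leading term of `p` contributes the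
dominant pole, which cannot cancel. -/
theorem evalPole_injective {v : PowerSeries K} (hv : PowerSeries.constantCoeff v ≠ 0) :
    Function.Injective (evalPole (F := F) v) := by
  rw [injective_iff_map_eq_zero]
  intro p hp
  by_contra h
  have h1 := algebraMap_eval_poleScale p v
  rw [hp, mul_zero, map_eq_zero_iff _ algebraMap_powerSeries_injective] at h1
  have h2 := constantCoeff_eval_poleScale p v
  rw [h1, map_zero] at h2
  have : algebraMap F K p.leadingCoeff ≠ 0 := by simpa using h
  exact mul_ne_zero this (pow_ne_zero _ hv) h2.symm

theorem natCast_ne_zero_of_algebra (K : Type*) [Field K] [Algebra F K] {n : ℕ} (hn : (n : F) ≠ 0) :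
    (n : K) ≠ 0 := by
  rwa [← map_natCast (algebraMap F K), Ne, map_eq_zero]

theorem le_of_X_pow_mul_eq {a b : ℕ} {t : FractionRing (PowerSeries K)} {s s' : PowerSeries K}
    (h : (algebraMap _ _ (PowerSeries.X : PowerSeries K)) ^ a * t = algebraMap _ _ s)
    (h' : (algebraMap _ _ (PowerSeries.X : PowerSeries K)) ^ b * t = algebraMap _ _ s')
    (hs' : PowerSeries.constantCoeff s' ≠ 0) : b ≤ a := by
  by_contra hab
  rw [not_le] at hab
  obtain ⟨k, rfl⟩ := Nat.exists_eq_add_of_lt hab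
  apply hs'
  rw [show a + k + 1 = (k + 1) + a by ring, pow_add, mul_assoc, h, ← map_pow, ← map_mul] at h'
  rw [← algebraMap_powerSeries_injective h']
  simp

/-- The degree of a polynomial is its pole order. -/
theorem natDegree_eq_of_X_pow_mul_evalPole {p : F[X]} {v s : PowerSeries K} {a : ℕ}
    (hv : PowerSeries.constantCoeff v ≠ 0) (hs : PowerSeries.constantCoeff s ≠ 0)
    (h : (algebraMap _ _ (PowerSeries.X : PowerSeries K)) ^ a * evalPole v p =
      algebraMap _ _ s) : p.natDegree = a := by
  have hp : p ≠ 0 := by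
    rintro rfl
    rw [map_zero, mul_zero, eq_comm, map_eq_zero_iff _ algebraMap_powerSeries_injective] at h
    exact hs (by simp [h])
  have h1 := (algebraMap_eval_poleScale p v).symm
  have h2 := constantCoeff_eval_poleScale p v
  apply le_antisymm
  · refine le_of_X_pow_mul_eq h h1 ?_
    rw [h2]
    exact mul_ne_zero (by simpa using hp) (pow_ne_zero _ hv)
  · exact le_of_X_pow_mul_eq h1 h hs

/-- Hensel lifting of a solution of `p(w / z) = p(v / z)`. -/
theorem exists_evalPole_eq {p : F[X]} (hp : p.Monic) (hn : (p.natDegree : F) ≠ 0)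
    {v : PowerSeries K} {c : K} (hc : c ≠ 0)
    (hcv : c ^ p.natDegree = PowerSeries.constantCoeff v ^ p.natDegree) :
    ∃ w : PowerSeries K, PowerSeries.constantCoeff w = c ∧ evalPole w p = evalPole v p := by
  have hdeg : p.natDegree ≠ 0 := fun h => hn (by simp [h])
  have hm : (poleScale K p).Monic := (monic_scaleRoots_iff _).2 (hp.map _)
  have hH : (poleScale K p - C ((poleScale K p).eval v)).Monic := by
    refine hm.sub_of_left ?_
    refine lt_of_le_of_lt degree_C_le ?_
    rw [← natDegree_pos_iff_degree_pos, poleScale_natDegree]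
    exact Nat.pos_of_ne_zero hdeg
  -- Modulo `z` the equation reads `W ^ m = v₀ ^ m` with `m = deg p`; its root `c` is simple because
  -- `m * c ^ (m - 1) ≠ 0`, which is where tameness enters.
  obtain ⟨w, hw, hwc⟩ := HenselianRing.is_henselian
    (I := Ideal.span {(PowerSeries.X : PowerSeries K)}) _ hH (PowerSeries.C c) (by
      rw [Ideal.mem_span_singleton, PowerSeries.X_dvd_iff, eval_sub, eval_C, map_sub,
        constantCoeff_eval_poleScale, constantCoeff_eval_poleScale, PowerSeries.constantCoeff_C, hcv,
        sub_self]) (by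
      apply IsUnit.map
      rw [PowerSeries.isUnit_iff_constantCoeff, derivative_sub, derivative_C, sub_zero,
        constantCoeff_eval_derivative_poleScale, hp.leadingCoeff, map_one, one_mul,
        PowerSeries.constantCoeff_C, isUnit_iff_ne_zero]
      refine mul_ne_zero ?_ (pow_ne_zero _ hc)
      exact natCast_ne_zero_of_algebra K hn)
  refine ⟨w, ?_, ?_⟩
  · rw [Ideal.mem_span_singleton, PowerSeries.X_dvd_iff, map_sub, PowerSeries.constantCoeff_C,
      sub_eq_zero] at hwc
    exact hwc
  · rw [IsRoot.def, eval_sub, eval_C, sub_eq_zero] at hw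
    apply mul_left_cancel₀ (pow_ne_zero p.natDegree (algebraMap_X_ne_zero (K := K)))
    rw [← algebraMap_eval_poleScale, ← algebraMap_eval_poleScale, hw]

/-- Uniqueness in Hensel's lemma: in the Taylor expansion at `v`, the cofactor of `w - v` has a
nonzero constant coefficient. -/
theorem eq_of_evalPole_eq {p : F[X]} (hp : p.Monic) (hn : (p.natDegree : F) ≠ 0)
    {v w : PowerSeries K} (hv : PowerSeries.constantCoeff v ≠ 0)
    (hvw : PowerSeries.constantCoeff v = PowerSeries.constantCoeff w)
    (h : evalPole v p = evalPole w p) : v = w := by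
  have h1 : (poleScale K p).eval v = (poleScale K p).eval w := by
    apply algebraMap_powerSeries_injective
    rw [algebraMap_eval_poleScale, algebraMap_eval_poleScale, h]
  obtain ⟨k, hk⟩ := binomExpansion (poleScale K p) v (w - v)
  rw [add_sub_cancel, ← h1, add_assoc, left_eq_add, sq, ← mul_assoc, ← add_mul, mul_eq_zero,
    sub_eq_zero] at hk
  rcases hk with hk | hk
  · have h2 := congrArg PowerSeries.constantCoeff hk
    rw [map_add, map_mul, map_sub, hvw, sub_self, mul_zero, add_zero,
      constantCoeff_eval_derivative_poleScale, hp.leadingCoeff, map_one, one_mul, map_zero] at h2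
    refine absurd h2 (mul_ne_zero ?_ (pow_ne_zero _ hv))
    exact natCast_ne_zero_of_algebra K hn
  · exact hk.symm

/-! ### Families of roots -/

/-- `y c / z` for `c ^ n = 1` are the roots of `f(Y) = f(1 / z)`, labelled by their leading
coefficients. -/
def IsRootFamily (f : F[X]) (y : K → PowerSeries K) : Prop :=
  ∀ c : K, c ^ f.natDegree = 1 →
    PowerSeries.constantCoeff (y c) = c ∧ evalPole (y c) f = evalPole 1 f

theorem exists_isRootFamily (K : Type*) [Field K] [Algebra F K] {f : F[X]} (hf : f.Monic)
    (hn : (f.natDegree : F) ≠ 0) : ∃ y : K → PowerSeries K, IsRootFamily f y := by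
  have h : ∀ c : K, ∃ w : PowerSeries K, c ^ f.natDegree = 1 →
      PowerSeries.constantCoeff w = c ∧ evalPole w f = evalPole 1 f := by
    intro c
    by_cases hc : c ^ f.natDegree = 1
    · have hc0 : c ≠ 0 := by
        rintro rfl
        rw [zero_pow (fun h => hn (by simp [h]))] at hc
        exact zero_ne_one hc
      obtain ⟨w, hw⟩ := exists_evalPole_eq hf hn (v := 1) hc0 (by simpa using hc)
      exact ⟨w, fun _ => hw⟩
    -- The series `0` is a default for labels that are not roots of unity of the required order.
    · exact ⟨0, fun h => absurd h hc⟩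
  choose y hy using h
  exact ⟨y, hy⟩

/-- `p` takes the same value at any two roots of `f(Y) = f(1 / z)` whose labels differ by an `l`-th
root of unity. -/
def IsInvariant (f : F[X]) (y : K → PowerSeries K) (l : ℕ) (p : F[X]) : Prop :=
  ∀ c c' : K, c ^ f.natDegree = 1 → c' ^ f.natDegree = 1 → c ^ l = c' ^ l →
    evalPole (y c) p = evalPole (y c') p

variable {f : F[X]} {y : K → PowerSeries K}

theorem IsRootFamily.constantCoeff_ne_zero (hy : IsRootFamily f y) (hn : (f.natDegree : F) ≠ 0)
    {c : K} (hc : c ^ f.natDegree = 1) : PowerSeries.constantCoeff (y c) ≠ 0 := by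
  rw [(hy c hc).1]
  rintro rfl
  rw [zero_pow (fun h => hn (by simp [h]))] at hc
  exact zero_ne_one hc

theorem IsRootFamily.isInvariant_self (hy : IsRootFamily f y) (l : ℕ) : IsInvariant f y l f :=
  fun c c' hc hc' _ => (hy c hc).2.trans (hy c' hc').2.symm

theorem IsInvariant.of_dvd {l m : ℕ} {p : F[X]} (h : IsInvariant f y m p) (hlm : l ∣ m) :
    IsInvariant f y l p := by
  obtain ⟨k, rfl⟩ := hlm
  exact fun c c' hc hc' hcc => h c c' hc hc' (by rw [pow_mul, pow_mul, hcc])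

theorem isInvariant_C (l : ℕ) (a : F) : IsInvariant f y l (C a) := by
  intro c c' _ _ _
  rw [evalPole_C, evalPole_C]

theorem IsInvariant.sub {l : ℕ} {p q : F[X]} (hp : IsInvariant f y l p)
    (hq : IsInvariant f y l q) : IsInvariant f y l (p - q) := by
  intro c c' hc hc' hcc
  rw [map_sub, map_sub, hp c c' hc hc' hcc, hq c c' hc hc' hcc]

theorem IsInvariant.mul {l : ℕ} {p q : F[X]} (hp : IsInvariant f y l p)
    (hq : IsInvariant f y l q) : IsInvariant f y l (p * q) := by
  intro c c' hc hc' hcc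
  rw [map_mul, map_mul, hp c c' hc hc' hcc, hq c c' hc hc' hcc]

theorem IsInvariant.pow {l : ℕ} {p : F[X]} (hp : IsInvariant f y l p) (k : ℕ) :
    IsInvariant f y l (p ^ k) := by
  intro c c' hc hc' hcc
  rw [map_pow, map_pow, hp c c' hc hc' hcc]

theorem natCast_ne_zero_of_dvd {l n : ℕ} (hn : (n : F) ≠ 0) (hl : l ∣ n) : (l : F) ≠ 0 := by
  obtain ⟨k, rfl⟩ := hl
  rw [Nat.cast_mul] at hn
  exact left_ne_zero_of_mul hn

/-- Hensel lifting for `h` gives a point with leading coefficient `c'` where `h` has its value at `y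
c`. That point is also a root of `f(Y) = f(1 / z)`, hence equals `y c'` by uniqueness. -/
theorem isInvariant_of_eq_comp (hy : IsRootFamily f y) (hf : f.Monic)
    (hn : (f.natDegree : F) ≠ 0) {g h : F[X]} (hh : h.Monic) (hgh : f = g.comp h) :
    IsInvariant f y h.natDegree h := by
  intro c c' hc hc' hcc
  have hr : (h.natDegree : F) ≠ 0 := by
    apply natCast_ne_zero_of_dvd hn
    conv_rhs => rw [hgh, natDegree_comp]
    exact Dvd.intro_left _ rfl
  have hc0 := hy.constantCoeff_ne_zero hn hc'
  obtain ⟨w, hw, hwh⟩ := exists_evalPole_eq hh hr (v := y c) hc0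
    (by rw [(hy c hc).1, (hy c' hc').1, hcc])
  have h1 : evalPole (y c') f = evalPole w f := by
    rw [(hy c' hc').2, ← (hy c hc).2, hgh, evalPole_comp, evalPole_comp, hwh]
  rw [eq_of_evalPole_eq hf hn hc0 hw.symm h1, hwh]

/-! ### Invariant polynomials as polynomials in a right component -/

section IsAlgClosed

variable [IsAlgClosed K]

theorem exists_isPrimitiveRoot (K : Type*) [Field K] [Algebra F K] [IsAlgClosed K] {l : ℕ}
    (hl : (l : F) ≠ 0) : ∃ ζ : K, IsPrimitiveRoot ζ l := by
  have : NeZero (l : K) := ⟨natCast_ne_zero_of_algebra K hl⟩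
  exact HasEnoughRootsOfUnity.exists_primitiveRoot K l

/-- Comparing the dominant poles at the labels `ζ` and `1`, with `ζ` a primitive `l`-th root of
unity, gives `ζ ^ deg p = 1`. -/
theorem IsInvariant.dvd_natDegree (hy : IsRootFamily f y) (hn : (f.natDegree : F) ≠ 0) {l : ℕ}
    (hl : l ∣ f.natDegree) {p : F[X]} (hp : IsInvariant f y l p) : l ∣ p.natDegree := by
  by_cases hp0 : p = 0
  · simp [hp0]
  obtain ⟨ζ, hζ⟩ := exists_isPrimitiveRoot K (natCast_ne_zero_of_dvd hn hl)
  have hζn : ζ ^ f.natDegree = 1 := (hζ.pow_eq_one_iff_dvd _).2 hl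
  have h1 := hp ζ 1 hζn (one_pow _) (by rw [hζ.pow_eq_one, one_pow])
  have h2 : (poleScale K p).eval (y ζ) = (poleScale K p).eval (y 1) := by
    apply algebraMap_powerSeries_injective
    rw [algebraMap_eval_poleScale, algebraMap_eval_poleScale, h1]
  have h3 := congrArg PowerSeries.constantCoeff h2
  rw [constantCoeff_eval_poleScale, constantCoeff_eval_poleScale, (hy ζ hζn).1,
    (hy 1 (one_pow _)).1, one_pow] at h3
  rw [← hζ.pow_eq_one_iff_dvd]
  exact mul_left_cancel₀ (by simpa using hp0) h3

/-- The degree of `p` is a multiple of `deg u`, so a constant multiple of a power of `u` cancels its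
leading term. The difference is again invariant, and induction on the degree applies. -/
theorem IsInvariant.exists_eq_comp (hy : IsRootFamily f y) (hn : (f.natDegree : F) ≠ 0) {u : F[X]}
    (hu : IsInvariant f y u.natDegree u) (hl : u.natDegree ∣ f.natDegree) {p : F[X]}
    (hp : IsInvariant f y u.natDegree p) : ∃ q : F[X], p = q.comp u := by
  have hu0 : u.natDegree ≠ 0 := fun h => natCast_ne_zero_of_dvd hn hl (by simp [h])
  have hune : u ≠ 0 := by rintro rfl; simp at hu0
  induction hd : p.natDegree using Nat.strong_induction_on generalizing p with
  | _ d ih =>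
    obtain ⟨k, hk⟩ := hp.dvd_natDegree hy hn hl
    by_cases hp0 : p.natDegree = 0
    · rw [eq_C_of_natDegree_eq_zero hp0]
      exact ⟨C (p.coeff 0), by simp⟩
    have hpne : p ≠ 0 := by rintro rfl; simp at hp0
    set t : F[X] := C (p.leadingCoeff / u.leadingCoeff ^ k) * u ^ k with ht
    have hulc : u.leadingCoeff ^ k ≠ 0 := pow_ne_zero _ (leadingCoeff_ne_zero.2 hune)
    have ha : p.leadingCoeff / u.leadingCoeff ^ k ≠ 0 :=
      div_ne_zero (leadingCoeff_ne_zero.2 hpne) hulc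
    have htd : t.natDegree = p.natDegree := by
      rw [ht, natDegree_C_mul ha, natDegree_pow, hk, mul_comm]
    have htne : t ≠ 0 := by intro h0; rw [h0, natDegree_zero] at htd; exact hp0 htd.symm
    have hlc : p.leadingCoeff = t.leadingCoeff := by
      rw [ht, leadingCoeff_mul, leadingCoeff_C, leadingCoeff_pow, div_mul_cancel₀ _ hulc]
    have hlt : (p - t).degree < p.degree := degree_sub_lt_left
      (by rw [degree_eq_natDegree hpne, degree_eq_natDegree htne, htd]) hpne hlc
    have hpt : IsInvariant f y u.natDegree (p - t) :=
      hp.sub ((isInvariant_C _ _).mul (hu.pow k))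
    have hq : ∃ q : F[X], p - t = q.comp u := by
      by_cases h0 : p - t = 0
      · exact ⟨0, by simp [h0]⟩
      · exact ih _ (hd ▸ natDegree_lt_natDegree h0 hlt) hpt rfl
    obtain ⟨q, hq⟩ := hq
    refine ⟨q + C (p.leadingCoeff / u.leadingCoeff ^ k) * X ^ k, ?_⟩
    rw [add_comp, ← hq, mul_comp, C_comp, X_pow_comp, ← ht, sub_add_cancel]

/-- Invariance supplies `deg h` roots, distinct because their leading coefficients `c * ζ` are;
there is no room for more. -/
theorem IsInvariant.map_sub_C_eq_prod (hy : IsRootFamily f y)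
    (hn : (f.natDegree : F) ≠ 0) {h : F[X]} (hh : h.Monic)
    (hi : IsInvariant f y h.natDegree h) (hl : h.natDegree ∣ f.natDegree) {c : K}
    (hc : c ^ f.natDegree = 1) :
    h.map (laurentC F K) - C (evalPole (y c) h) =
      ∏ ζ ∈ nthRootsFinset h.natDegree (1 : K), (X - C (polePoint (y (c * ζ)))) := by
  have hr := natCast_ne_zero_of_dvd hn hl
  have hr0 : 0 < h.natDegree := Nat.pos_of_ne_zero fun h0 => hr (by simp [h0])
  obtain ⟨ω, hω⟩ := exists_isPrimitiveRoot K hr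
  have hc0 : c ≠ 0 := by
    have := hy.constantCoeff_ne_zero hn hc
    rwa [(hy c hc).1] at this
  have hroot : ∀ ζ ∈ nthRootsFinset h.natDegree (1 : K), (c * ζ) ^ f.natDegree = 1 := by
    intro ζ hζ
    rw [mem_nthRootsFinset hr0] at hζ
    obtain ⟨k, hk⟩ := hl
    rw [mul_pow, hc, hk, pow_mul, hζ, one_pow, one_mul]
  symm
  apply eq_of_dvd_of_natDegree_le_of_leadingCoeff
  · apply Finset.prod_dvd_of_coprime
    · intro ζ hζ ζ' hζ' hne
      apply isCoprime_X_sub_C_of_isUnit_sub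
      rw [isUnit_iff_ne_zero, sub_ne_zero]
      intro he
      apply hne
      have := congrArg PowerSeries.constantCoeff (polePoint_injective he)
      rw [(hy _ (hroot ζ hζ)).1, (hy _ (hroot ζ' hζ')).1] at this
      exact mul_left_cancel₀ hc0 this
    · intro ζ hζ
      rw [dvd_iff_isRoot, IsRoot.def, eval_sub, eval_C, eval_map, sub_eq_zero]
      refine hi (c * ζ) c (hroot ζ hζ) hc ?_
      rw [mul_pow, (mem_nthRootsFinset hr0 _).1 hζ, mul_one]
  · rw [natDegree_finsetProd_X_sub_C_eq_card, hω.card_nthRootsFinset, natDegree_sub_C,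
      natDegree_map]
  · rw [(monic_prod_X_sub_C _ _).leadingCoeff]
    symm
    refine (hh.map _).sub_of_left ?_
    refine lt_of_le_of_lt degree_C_le ?_
    rwa [degree_map, ← natDegree_pos_iff_degree_pos]

end IsAlgClosed

end Puiseux

end TameCollisions

namespace TameCollisions

open Polynomial

/-! ### Greatest common divisors and least common multiples of degrees of right components -/

/-- Two monic polynomials over an integrally closed domain have a common divisor that becomes a
greatest common divisor over every field containing the domain. -/
theorem exists_map_gcd {R : Type*} [CommRing R] [IsDomain R] [IsIntegrallyClosed R] {A B : R[X]}
    (hA : A.Monic) : ∃ G : R[X], G.Monic ∧ ∀ (L : Type*) [Field L] (φ : R →+* L),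
      Function.Injective φ → G.map φ ∣ A.map φ ∧ G.map φ ∣ B.map φ ∧
        ∀ q, q ∣ A.map φ → q ∣ B.map φ → q ∣ G.map φ := by
  classical
  set α := algebraMap R (FractionRing R)
  obtain ⟨G, hG⟩ := IsIntegrallyClosed.eq_map_mul_C_of_dvd (FractionRing R)
    hA (EuclideanDomain.gcd_dvd_left (A.map α) (B.map α))
  have hne : EuclideanDomain.gcd (A.map α) (B.map α) ≠ 0 := by
    intro h0
    rw [EuclideanDomain.gcd_eq_zero_iff] at h0
    exact (hA.map α).ne_zero h0.1
  have hlc := leadingCoeff_ne_zero.2 hne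
  have hassoc : Associated (G.map α) (EuclideanDomain.gcd (A.map α) (B.map α)) := by
    conv_rhs => rw [← hG]
    exact associated_mul_unit_right _ _ (isUnit_C.2 hlc.isUnit)
  have hGm : (G.map α).Monic := by
    have h1 := congrArg leadingCoeff hG
    rw [leadingCoeff_mul, leadingCoeff_C] at h1
    exact mul_right_cancel₀ hlc (h1.trans (one_mul _).symm)
  refine ⟨G, monic_of_injective (IsFractionRing.injective R (FractionRing R)) hGm,
    fun L _ φ hφ => ?_⟩
  set Φ : FractionRing R →+* L := IsFractionRing.lift hφ
  have hΦ : ∀ P : R[X], (P.map α).map Φ = P.map φ := by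
    intro P
    rw [map_map]
    congr 1
    exact RingHom.ext fun p => IsFractionRing.lift_algebraMap hφ p
  have h2 : Associated (G.map φ) (EuclideanDomain.gcd (A.map φ) (B.map φ)) := by
    rw [← hΦ, ← hΦ, ← hΦ, gcd_map]
    exact hassoc.map (mapRingHom Φ)
  exact ⟨h2.dvd.trans (EuclideanDomain.gcd_dvd_left _ _),
    h2.dvd.trans (EuclideanDomain.gcd_dvd_right _ _),
    fun q h h' => (EuclideanDomain.dvd_gcd h h').trans h2.symm.dvd⟩

section Lattice

variable {F K : Type*} [Field F] [Field K] [Algebra F K] {f : F[X]}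
  {y : K → PowerSeries K}

/-- With the common factors removed, the two products are coprime, so Bézout shows that `p` divides
the product over the intersection. -/
theorem eq_prod_of_dvd_of_dvd {L ι : Type*} [Field L] [DecidableEq ι] {A B S : Finset ι} {a : ι → L}
    (ha : Set.InjOn a (A ∪ B : Finset ι)) (hS : S = A ∩ B) {p : L[X]} (hp : p.Monic)
    (h1 : p ∣ ∏ i ∈ A, (X - C (a i))) (h2 : p ∣ ∏ i ∈ B, (X - C (a i)))
    (h3 : ∀ q, q ∣ ∏ i ∈ A, (X - C (a i)) → q ∣ ∏ i ∈ B, (X - C (a i)) → q ∣ p) :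
    p = ∏ i ∈ S, (X - C (a i)) := by
  have hA : S ⊆ A := hS ▸ Finset.inter_subset_left
  have hB : S ⊆ B := hS ▸ Finset.inter_subset_right
  refine eq_of_monic_of_associated hp (monic_prod_X_sub_C _ _) (associated_of_dvd_dvd ?_
    (h3 _ (Finset.prod_dvd_prod_of_subset _ _ _ hA) (Finset.prod_dvd_prod_of_subset _ _ _ hB)))
  rw [← Finset.prod_sdiff hA] at h1
  rw [← Finset.prod_sdiff hB] at h2
  have hcop : IsCoprime (∏ i ∈ A \ S, (X - C (a i))) (∏ i ∈ B \ S, (X - C (a i))) := by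
    apply IsCoprime.prod_left
    intro i hi
    apply IsCoprime.prod_right
    intro j hj
    apply isCoprime_X_sub_C_of_isUnit_sub
    rw [isUnit_iff_ne_zero, sub_ne_zero]
    rw [Finset.mem_sdiff] at hi hj
    intro hij
    have := ha (Finset.mem_union_left _ hi.1) (Finset.mem_union_right _ hj.1) hij
    subst this
    exact hi.2 (hS ▸ Finset.mem_inter.2 ⟨hi.1, hj.1⟩)
  obtain ⟨r, s, hrs⟩ := hcop
  have := dvd_add (h1.mul_left r) (h2.mul_left s)
  rwa [← mul_assoc, ← mul_assoc, ← add_mul, hrs, one_mul] at this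

theorem nthRootsFinset_gcd {m n : ℕ} (hm : 0 < m) (hn : 0 < n) [DecidableEq K] :
    nthRootsFinset (Nat.gcd m n) (1 : K) = nthRootsFinset m 1 ∩ nthRootsFinset n 1 := by
  ext ζ
  rw [Finset.mem_inter, mem_nthRootsFinset (Nat.gcd_pos_of_pos_left _ hm),
    mem_nthRootsFinset hm, mem_nthRootsFinset hn]
  simp only [← orderOf_dvd_iff_pow_eq_one]
  exact Nat.dvd_gcd_iff

theorem IsRootFamily.polePoint_injOn (hy : IsRootFamily f y) (hn : (f.natDegree : F) ≠ 0) {c : K}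
    (hc : c ^ f.natDegree = 1) :
    Set.InjOn (fun ζ => polePoint (y (c * ζ))) {ζ : K | ζ ^ f.natDegree = 1} := by
  intro ζ hζ ζ' hζ' he
  have hc0 : c ≠ 0 := by
    have := hy.constantCoeff_ne_zero hn hc
    rwa [(hy c hc).1] at this
  have := congrArg PowerSeries.constantCoeff (polePoint_injective he)
  rw [(hy _ (by rw [mul_pow, hc, hζ, one_mul])).1,
    (hy _ (by rw [mul_pow, hc, hζ', one_mul])).1] at this
  exact mul_left_cancel₀ hc0 this

theorem pow_eq_one_of_mem_nthRootsFinset {l n : ℕ} (hl : 0 < l) (hln : l ∣ n) {ζ : K}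
    (hζ : ζ ∈ nthRootsFinset l (1 : K)) : ζ ^ n = 1 := by
  obtain ⟨k, rfl⟩ := hln
  rw [pow_mul, (mem_nthRootsFinset hl _).1 hζ, one_pow]

/-- The elements of a coset of the group of `l`-th roots of unity, enumerated from two of its
members. -/
theorem prod_nthRootsFinset_mul {M : Type*} [CommMonoid M] {l : ℕ} (hl : 0 < l) {c c' : K}
    (hc' : c' ≠ 0) (h : c ^ l = c' ^ l) (φ : K → M) :
    ∏ ζ ∈ nthRootsFinset l (1 : K), φ (c * ζ) = ∏ ζ ∈ nthRootsFinset l (1 : K), φ (c' * ζ) := by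
  have hc : c ≠ 0 := by
    rintro rfl
    rw [zero_pow hl.ne', eq_comm, pow_eq_zero_iff hl.ne'] at h
    exact hc' h
  refine Finset.prod_nbij' (fun ζ => c / c' * ζ) (fun ζ => c' / c * ζ) ?_ ?_ ?_ ?_ ?_
  · intro ζ hζ
    rw [mem_nthRootsFinset hl] at hζ ⊢
    rw [mul_pow, div_pow, h, div_self (pow_ne_zero _ hc'), hζ, one_mul]
  · intro ζ hζ
    rw [mem_nthRootsFinset hl] at hζ ⊢
    rw [mul_pow, div_pow, h, div_self (pow_ne_zero _ hc'), hζ, one_mul]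
  · intro ζ _; field_simp
  · intro ζ _; field_simp
  · intro ζ _; congr 1; field_simp

/-- Splits `η` into an `l`-th and an `m`-th root of unity; `θ` is the first part, found as a power
of `η ^ m`. -/
theorem exists_pow_eq_of_coprime {l m : ℕ} (h : Nat.Coprime l m) {η : K} (hη : η ^ (l * m) = 1) :
    ∃ θ : K, θ ^ l = 1 ∧ θ ^ m = η ^ m := by
  have h1 : (η ^ m) ^ l = 1 := by rw [← pow_mul, mul_comm, hη]
  obtain ⟨k, hk⟩ := exists_pow_eq_self_of_coprime (x := η ^ m) (n := m)
    (Nat.Coprime.coprime_dvd_right (orderOf_dvd_of_pow_eq_one h1) h.symm)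
  refine ⟨(η ^ m) ^ k, by rw [← pow_mul, mul_comm, pow_mul, h1, one_pow], ?_⟩
  rw [← pow_mul, mul_comm, pow_mul]
  exact hk

/-! ### Invariant polynomials of gcd degree and of coprime product degree -/

variable [IsAlgClosed K]

/-- Take the gcd in `F[X][Y]` of `h₁(Y) - h₁(X)` and `h₂(Y) - h₂(X)`. At `X = y_c / z` it has
exactly the common roots `y_{cζ} / z` with `ζ ^ g = 1`, so its constant term in `Y` has pole order
`g` and depends only on `c ^ g`. -/
theorem exists_isInvariant_gcd (hy : IsRootFamily f y)
    (hn : (f.natDegree : F) ≠ 0) {h₁ h₂ : F[X]} (hm₁ : h₁.Monic) (hm₂ : h₂.Monic)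
    (hi₁ : IsInvariant f y h₁.natDegree h₁) (hi₂ : IsInvariant f y h₂.natDegree h₂)
    (hl₁ : h₁.natDegree ∣ f.natDegree) (hl₂ : h₂.natDegree ∣ f.natDegree) :
    ∃ w : F[X], w.natDegree = Nat.gcd h₁.natDegree h₂.natDegree ∧
      IsInvariant f y (Nat.gcd h₁.natDegree h₂.natDegree) w := by
  classical
  have hn0 : 0 < f.natDegree := Nat.pos_of_ne_zero fun h => hn (by simp [h])
  have hr₁ : 0 < h₁.natDegree := Nat.pos_of_dvd_of_pos hl₁ hn0
  have hr₂ : 0 < h₂.natDegree := Nat.pos_of_dvd_of_pos hl₂ hn0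
  set g := Nat.gcd h₁.natDegree h₂.natDegree with hg
  have hg0 : 0 < g := Nat.gcd_pos_of_pos_left _ hr₁
  have hgn : g ∣ f.natDegree := (Nat.gcd_dvd_left _ _).trans hl₁
  have hmonic : ∀ h : F[X], h.Monic → 0 < h.natDegree →
      (h.map C - C h : F[X][X]).Monic := fun h hm hr => by
    refine (hm.map _).sub_of_left (lt_of_le_of_lt degree_C_le ?_)
    rwa [degree_map_eq_of_injective C_injective, ← natDegree_pos_iff_degree_pos]
  set B₁ : F[X][X] := h₁.map C - C h₁
  set B₂ : F[X][X] := h₂.map C - C h₂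
  obtain ⟨G, hGm, hG⟩ := exists_map_gcd (B := B₂) (hmonic h₁ hm₁ hr₁)
  have key : ∀ c : K, c ^ f.natDegree = 1 → G.map (evalPole (y c)) =
      ∏ ζ ∈ nthRootsFinset g (1 : K), (X - C (polePoint (y (c * ζ)))) := by
    intro c hc
    have hinj := evalPole_injective (F := F) (hy.constantCoeff_ne_zero hn hc)
    obtain ⟨hG₁, hG₂, hG₃⟩ := hG _ (evalPole (y c)) hinj
    have hB : ∀ h : F[X], (h.map C - C h : F[X][X]).map (evalPole (y c)) =
        h.map (laurentC F K) - C (evalPole (y c) h) := by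
      intro h
      rw [Polynomial.map_sub, map_C, map_map]
      congr 2
      ext a
      exact evalPole_C _ _
    have h1 := (hB h₁).trans (hi₁.map_sub_C_eq_prod hy hn hm₁ hl₁ hc)
    have h2 := (hB h₂).trans (hi₂.map_sub_C_eq_prod hy hn hm₂ hl₂ hc)
    rw [h1] at hG₁ hG₃
    rw [h2] at hG₂ hG₃
    refine eq_prod_of_dvd_of_dvd (A := nthRootsFinset h₁.natDegree 1)
      (B := nthRootsFinset h₂.natDegree 1) ?_ (nthRootsFinset_gcd hr₁ hr₂)
      (hGm.map _) hG₁ hG₂ hG₃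
    refine (hy.polePoint_injOn hn hc).mono ?_
    intro ζ hζ
    rcases Finset.mem_union.1 (Finset.mem_coe.1 hζ) with h | h
    · exact pow_eq_one_of_mem_nthRootsFinset hr₁ hl₁ h
    · exact pow_eq_one_of_mem_nthRootsFinset hr₂ hl₂ h
  have hval : ∀ c : K, c ^ f.natDegree = 1 → evalPole (y c) (G.coeff 0) =
      ∏ ζ ∈ nthRootsFinset g (1 : K), -polePoint (y (c * ζ)) := by
    intro c hc
    rw [← coeff_map, key c hc, coeff_zero_eq_eval_zero, eval_prod]
    simp
  obtain ⟨ω, hω⟩ := exists_isPrimitiveRoot K (natCast_ne_zero_of_dvd hn hgn)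
  refine ⟨G.coeff 0, ?_, ?_⟩
  · refine natDegree_eq_of_X_pow_mul_evalPole (v := y 1)
      (s := ∏ ζ ∈ nthRootsFinset g (1 : K), -y (1 * ζ))
      (hy.constantCoeff_ne_zero hn (one_pow _)) ?_ ?_
    · rw [map_prod, Finset.prod_ne_zero_iff]
      intro ζ hζ
      rw [map_neg, neg_ne_zero, one_mul]
      exact hy.constantCoeff_ne_zero hn (pow_eq_one_of_mem_nthRootsFinset hg0 hgn hζ)
    · rw [hval 1 (one_pow _), map_prod]
      have hcard : ∀ b : FractionRing (PowerSeries K), b ^ g =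
          ∏ ζ ∈ nthRootsFinset g (1 : K), b := fun b => by
        rw [Finset.prod_const, hω.card_nthRootsFinset]
      rw [hcard, ← Finset.prod_mul_distrib]
      refine Finset.prod_congr rfl fun ζ _ => ?_
      rw [mul_neg, X_mul_polePoint, map_neg]
  · intro c c' hc hc' hcc
    rw [hval c hc, hval c' hc']
    have hc0 : c' ≠ 0 := by
      have := hy.constantCoeff_ne_zero hn hc'
      rwa [(hy c' hc').1] at this
    exact prod_nthRootsFinset_mul hg0 hc0 hcc fun ζ => -polePoint (y ζ)

/-- The resultant in `Y` of `h₁(Y) - h₁(X)` and `h₂(Y)` is at `X = y_c / z` the product of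
`h₂(y_{cζ} / z)` over `ζ ^ r₁ = 1`. Multiplying `c` by an `r₁`-th root of unity permutes the
factors; an `r₂`-th root preserves each one. -/
theorem exists_isInvariant_mul_of_coprime (hy : IsRootFamily f y)
    (hn : (f.natDegree : F) ≠ 0) {h₁ h₂ : F[X]} (hm₁ : h₁.Monic) (hm₂ : h₂.Monic)
    (hi₁ : IsInvariant f y h₁.natDegree h₁) (hi₂ : IsInvariant f y h₂.natDegree h₂)
    (hl₁ : h₁.natDegree ∣ f.natDegree)
    (hcop : Nat.Coprime h₁.natDegree h₂.natDegree) :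
    ∃ u : F[X], u.natDegree = h₁.natDegree * h₂.natDegree ∧
      IsInvariant f y (h₁.natDegree * h₂.natDegree) u := by
  have hn0 : 0 < f.natDegree := Nat.pos_of_ne_zero fun h => hn (by simp [h])
  have hr₁ : 0 < h₁.natDegree := Nat.pos_of_dvd_of_pos hl₁ hn0
  have hroot : ∀ c ζ : K, c ^ f.natDegree = 1 → ζ ∈ nthRootsFinset h₁.natDegree (1 : K) →
      (c * ζ) ^ f.natDegree = 1 := by
    intro c ζ hc hζ
    rw [mul_pow, hc, pow_eq_one_of_mem_nthRootsFinset hr₁ hl₁ hζ, one_mul]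
  obtain ⟨ω, hω⟩ := exists_isPrimitiveRoot K (natCast_ne_zero_of_dvd hn hl₁)
  set u : F[X] := resultant (h₁.map C - C h₁ : F[X][X]) (h₂.map C) h₁.natDegree h₂.natDegree
  have hval : ∀ c : K, c ^ f.natDegree = 1 → evalPole (y c) u =
      ∏ ζ ∈ nthRootsFinset h₁.natDegree (1 : K), evalPole (y (c * ζ)) h₂ := by
    intro c hc
    have hC : (evalPole (y c)).comp C = laurentC F K := by
      ext a; exact evalPole_C _ _
    have hB : (h₁.map C - C h₁ : F[X][X]).map (evalPole (y c)) =
        h₁.map (laurentC F K) - C (evalPole (y c) h₁) := by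
      rw [Polynomial.map_sub, map_C, map_map, hC]
    rw [← resultant_map_map, hB, hi₁.map_sub_C_eq_prod hy hn hm₁ hl₁ hc, map_map, hC]
    have h1 := resultant_prod_left (nthRootsFinset h₁.natDegree (1 : K))
      (fun ζ => X - C (polePoint (y (c * ζ)))) (h₂.map (laurentC F K)) h₂.natDegree
      (by simp [leadingCoeff_X_sub_C]) (natDegree_map _).le
    rw [natDegree_finsetProd_X_sub_C_eq_card, hω.card_nthRootsFinset] at h1
    rw [h1]
    refine Finset.prod_congr rfl fun ζ _ => ?_
    rw [natDegree_X_sub_C, resultant_X_sub_C_left _ _ _ (natDegree_map _).le, eval_map]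
    rfl
  refine ⟨u, ?_, ?_⟩
  · refine natDegree_eq_of_X_pow_mul_evalPole (v := y 1)
      (s := ∏ ζ ∈ nthRootsFinset h₁.natDegree (1 : K), (poleScale K h₂).eval (y (1 * ζ)))
      (hy.constantCoeff_ne_zero hn (one_pow _)) ?_ ?_
    · rw [map_prod, Finset.prod_ne_zero_iff]
      intro ζ hζ
      rw [constantCoeff_eval_poleScale, hm₂.leadingCoeff, map_one, one_mul]
      exact pow_ne_zero _ (hy.constantCoeff_ne_zero hn (hroot 1 ζ (one_pow _) hζ))
    · rw [hval 1 (one_pow _), map_prod, mul_comm h₁.natDegree, pow_mul]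
      have hcard : ∀ b : FractionRing (PowerSeries K), b ^ h₁.natDegree =
          ∏ ζ ∈ nthRootsFinset h₁.natDegree (1 : K), b := fun b => by
        rw [Finset.prod_const, hω.card_nthRootsFinset]
      rw [hcard, ← Finset.prod_mul_distrib]
      exact Finset.prod_congr rfl fun ζ _ => (algebraMap_eval_poleScale _ _).symm
  · intro c c' hc hc' hcc
    have hc0 : c' ≠ 0 := by
      have := hy.constantCoeff_ne_zero hn hc'
      rwa [(hy c' hc').1] at this
    -- Pass from `c'` to `c' * θ` by permuting the factors, and from there to `c` by invariance of
    -- `h₂`.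
    obtain ⟨θ, hθ₁, hθ₂⟩ := exists_pow_eq_of_coprime hcop (η := c / c')
      (by rw [div_pow, hcc, div_self (pow_ne_zero _ hc0)])
    rw [hval c hc, hval c' hc', ← prod_nthRootsFinset_mul (c := c' * θ) hr₁ hc0
      (by rw [mul_pow, hθ₁, mul_one]) fun ζ => evalPole (y ζ) h₂]
    refine Finset.prod_congr rfl fun ζ hζ => hi₂ _ _ (hroot c ζ hc hζ) ?_ ?_
    · obtain ⟨k, hk⟩ := hl₁
      refine hroot _ ζ ?_ hζ
      rw [mul_pow, hc', hk, pow_mul, hθ₁, one_pow, mul_one]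
    · rw [mul_pow, mul_pow, mul_pow, hθ₂, div_pow, mul_div_cancel₀ _ (pow_ne_zero _ hc0)]

end Lattice

end TameCollisions

namespace TameCollisions

open Polynomial

/-! ### Degrees of right components -/

section RightDegrees

variable {F : Type*} [Field F] {f : F[X]}

/-- The degrees of the monic original right components of `f`. -/
def rightDegrees (f : F[X]) : Set ℕ := {r | ∃ h ∈ monicOriginal F r, ∃ g : F[X], f = g.comp h}

theorem dvd_of_mem_rightDegrees {r : ℕ} (hr : r ∈ rightDegrees f) : r ∣ f.natDegree := by
  obtain ⟨h, hh, g, rfl⟩ := hr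
  rw [natDegree_comp, hh.2.1]
  exact Dvd.intro_left _ rfl

/-- The affine polynomial whose composition with `p` is monic and original. -/
noncomputable def normalizer (p : F[X]) : F[X] := C p.leadingCoeff⁻¹ * (X - C (p.eval 0))

theorem normalizer_comp (p : F[X]) :
    (normalizer p).comp p = C p.leadingCoeff⁻¹ * (p - C (p.eval 0)) := by
  simp [normalizer]

theorem normalizer_comp_mem {p : F[X]} (hp : p.natDegree ≠ 0) :
    (normalizer p).comp p ∈ monicOriginal F p.natDegree := by
  have hp0 : p.leadingCoeff ≠ 0 := by
    rw [Ne, leadingCoeff_eq_zero]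
    rintro rfl
    simp at hp
  rw [normalizer_comp]
  refine ⟨?_, ?_, by simp⟩
  · rw [Monic, leadingCoeff_mul, leadingCoeff_C, leadingCoeff_sub_of_degree_lt, inv_mul_cancel₀ hp0]
    exact lt_of_le_of_lt degree_C_le (natDegree_pos_iff_degree_pos.1 (Nat.pos_of_ne_zero hp))
  · rw [natDegree_C_mul (inv_ne_zero hp0), natDegree_sub_C]

theorem natDegree_normalizer {p : F[X]} (hp : p ≠ 0) : (normalizer p).natDegree = 1 := by
  rw [normalizer, natDegree_C_mul (inv_ne_zero (leadingCoeff_ne_zero.2 hp)), natDegree_X_sub_C]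

theorem comp_normalizer_comp {p : F[X]} (hp : p ≠ 0) :
    (C p.leadingCoeff * X + C (p.eval 0)).comp ((normalizer p).comp p) = p := by
  rw [normalizer_comp]
  simp only [add_comp, mul_comp, C_comp, X_comp]
  rw [← mul_assoc, ← C_mul, mul_inv_cancel₀ (leadingCoeff_ne_zero.2 hp), C_1, one_mul,
    sub_add_cancel]

theorem natDegree_mem_rightDegrees {p q : F[X]} (hp : p.natDegree ≠ 0) (h : f = q.comp p) :
    p.natDegree ∈ rightDegrees f := by
  refine ⟨_, normalizer_comp_mem hp, q.comp (C p.leadingCoeff * X + C (p.eval 0)), ?_⟩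
  rw [comp_assoc, comp_normalizer_comp (by rintro rfl; simp at hp), h]

/-- The component of larger degree inherits the invariance of the smaller degree, hence is a
polynomial in the smaller component. -/
theorem exists_eq_comp_of_dvd (hf : f.Monic) (hn : (f.natDegree : F) ≠ 0) {r r' : ℕ}
    (hr : r ∣ r') {h h' g g' : F[X]} (hh : h ∈ monicOriginal F r) (hh' : h' ∈ monicOriginal F r')
    (hg : f = g.comp h) (hg' : f = g'.comp h') : ∃ q : F[X], h' = q.comp h := by
  obtain ⟨y, hy⟩ := exists_isRootFamily (AlgebraicClosure F) hf hn
  have h1 := isInvariant_of_eq_comp hy hf hn hh.1 hg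
  have h2 := isInvariant_of_eq_comp hy hf hn hh'.1 hg'
  have hd : r ∣ f.natDegree := dvd_of_mem_rightDegrees ⟨h, hh, g, hg⟩
  obtain rfl := hh.2.1
  obtain rfl := hh'.2.1
  exact h1.exists_eq_comp hy hn hd (h2.of_dvd hr)

theorem mem_rightDegrees_comp {r : ℕ} {g h : F[X]} (hr : r ∈ rightDegrees h) :
    r ∈ rightDegrees (g.comp h) := by
  obtain ⟨k, hk, q, rfl⟩ := hr
  exact ⟨k, hk, g.comp q, (comp_assoc _ _ _).symm⟩

theorem mem_rightDegrees_of_dvd (hf : f.Monic) (hn : (f.natDegree : F) ≠ 0) {r r' : ℕ}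
    {g h : F[X]} (hh : h ∈ monicOriginal F r') (hg : f = g.comp h)
    (hr : r ∣ r') (hrf : r ∈ rightDegrees f) : r ∈ rightDegrees h := by
  obtain ⟨k, hk, q, hq⟩ := hrf
  exact ⟨k, hk, exists_eq_comp_of_dvd hf hn hr hk hh hq hg⟩

/-- `f` is invariant for every modulus, so it is itself a polynomial in `u`. -/
theorem mem_rightDegrees_of_isInvariant {K : Type*} [Field K] [Algebra F K] [IsAlgClosed K]
    {y : K → PowerSeries K} (hy : IsRootFamily f y) (hn : (f.natDegree : F) ≠ 0) {u : F[X]}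
    (hu : IsInvariant f y u.natDegree u) (hl : u.natDegree ∣ f.natDegree) :
    u.natDegree ∈ rightDegrees f := by
  obtain ⟨q, hq⟩ := hu.exists_eq_comp hy hn hl (hy.isInvariant_self _)
  exact natDegree_mem_rightDegrees
    (fun h => natCast_ne_zero_of_dvd hn hl (by simp [h])) hq

theorem gcd_mem_rightDegrees (hf : f.Monic) (hn : (f.natDegree : F) ≠ 0) {r₁ r₂ : ℕ}
    (hr₁ : r₁ ∈ rightDegrees f) (hr₂ : r₂ ∈ rightDegrees f) :
    Nat.gcd r₁ r₂ ∈ rightDegrees f := by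
  obtain ⟨y, hy⟩ := exists_isRootFamily (AlgebraicClosure F) hf hn
  have hd₁ := dvd_of_mem_rightDegrees hr₁
  have hd₂ := dvd_of_mem_rightDegrees hr₂
  obtain ⟨h₁, hh₁, g₁, hg₁⟩ := hr₁
  obtain ⟨h₂, hh₂, g₂, hg₂⟩ := hr₂
  obtain rfl := hh₁.2.1
  obtain rfl := hh₂.2.1
  obtain ⟨w, hw, hwi⟩ := exists_isInvariant_gcd hy hn hh₁.1 hh₂.1
    (isInvariant_of_eq_comp hy hf hn hh₁.1 hg₁) (isInvariant_of_eq_comp hy hf hn hh₂.1 hg₂) hd₁ hd₂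
  rw [← hw] at hwi ⊢
  exact mem_rightDegrees_of_isInvariant hy hn hwi (hw ▸ (Nat.gcd_dvd_left _ _).trans hd₁)

theorem mul_mem_rightDegrees_of_coprime (hf : f.Monic) (hn : (f.natDegree : F) ≠ 0) {r₁ r₂ : ℕ}
    (hr₁ : r₁ ∈ rightDegrees f) (hr₂ : r₂ ∈ rightDegrees f) (hcop : Nat.Coprime r₁ r₂) :
    r₁ * r₂ ∈ rightDegrees f := by
  obtain ⟨y, hy⟩ := exists_isRootFamily (AlgebraicClosure F) hf hn
  have hd₁ := dvd_of_mem_rightDegrees hr₁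
  have hd₂ := dvd_of_mem_rightDegrees hr₂
  obtain ⟨h₁, hh₁, g₁, hg₁⟩ := hr₁
  obtain ⟨h₂, hh₂, g₂, hg₂⟩ := hr₂
  obtain rfl := hh₁.2.1
  obtain rfl := hh₂.2.1
  obtain ⟨u, hu, hui⟩ := exists_isInvariant_mul_of_coprime hy hn hh₁.1 hh₂.1
    (isInvariant_of_eq_comp hy hf hn hh₁.1 hg₁) (isInvariant_of_eq_comp hy hf hn hh₂.1 hg₂) hd₁
    hcop
  rw [← hu] at hui ⊢
  exact mem_rightDegrees_of_isInvariant hy hn hui (hu ▸ hcop.mul_dvd_of_dvd_of_dvd hd₁ hd₂)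

theorem comp_right_cancel {p q w : F[X]} (hw : w.natDegree ≠ 0) (h : p.comp w = q.comp w) :
    p = q := by
  have h1 : (p - q).comp w = 0 := by rw [sub_comp, h, sub_self]
  rcases comp_eq_zero_iff.1 h1 with h2 | h2
  · exact sub_eq_zero.1 h2
  · exact absurd (by rw [h2.2, natDegree_C]) hw

theorem monic_of_monic_comp {p w : F[X]} (hw : w.Monic) (hw0 : w.natDegree ≠ 0)
    (h : (p.comp w).Monic) : p.Monic := by
  rw [Monic, leadingCoeff_comp hw0, hw.leadingCoeff, one_pow, mul_one] at h
  exact h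

/-- Split off the component `w` of gcd degree. Both components factor through `w`, their left parts
have coprime degrees and are right components of `f'`, and the coprime case can be composed with `w`
again. -/
theorem lcm_mem_rightDegrees (hf : f.Monic) (hn : (f.natDegree : F) ≠ 0) {r₁ r₂ : ℕ}
    (hr₁ : r₁ ∈ rightDegrees f) (hr₂ : r₂ ∈ rightDegrees f) :
    Nat.lcm r₁ r₂ ∈ rightDegrees f := by
  have hn0 : 0 < f.natDegree := Nat.pos_of_ne_zero fun h => hn (by simp [h])
  have hd₁ := dvd_of_mem_rightDegrees hr₁
  have hr₁0 : 0 < r₁ := Nat.pos_of_dvd_of_pos hd₁ hn0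
  have hg0 : 0 < Nat.gcd r₁ r₂ := Nat.gcd_pos_of_pos_left _ hr₁0
  obtain ⟨w, hw, f', hf'⟩ := gcd_mem_rightDegrees hf hn hr₁ hr₂
  have hwd : w.natDegree ≠ 0 := hw.2.1.trans_ne hg0.ne'
  have hf'm : f'.Monic := monic_of_monic_comp hw.1 hwd (hf' ▸ hf)
  have hf'n : (f'.natDegree : F) ≠ 0 := by
    apply natCast_ne_zero_of_dvd hn
    conv_rhs => rw [hf', natDegree_comp]
    exact Dvd.intro _ rfl
  have key : ∀ r, Nat.gcd r₁ r₂ ∣ r → r ∈ rightDegrees f →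
      r / Nat.gcd r₁ r₂ ∈ rightDegrees f' := by
    rintro r hgr ⟨h, hh, q, hq⟩
    obtain ⟨k, rfl⟩ := exists_eq_comp_of_dvd hf hn hgr hw hh hf' hq
    refine ⟨k, ⟨monic_of_monic_comp hw.1 hwd hh.1, ?_, ?_⟩, q, ?_⟩
    · have := hh.2.1
      rw [natDegree_comp, hw.2.1] at this
      rw [← this, Nat.mul_div_cancel _ hg0]
    · have := hh.2.2
      rwa [eval_comp, hw.2.2] at this
    · apply comp_right_cancel hwd
      rw [← hf', hq, comp_assoc]
  obtain ⟨u, hu, v, hv⟩ := mul_mem_rightDegrees_of_coprime hf'm hf'n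
    (key r₁ (Nat.gcd_dvd_left _ _) hr₁) (key r₂ (Nat.gcd_dvd_right _ _) hr₂)
    (Nat.coprime_div_gcd_div_gcd hg0)
  refine ⟨u.comp w, ⟨hu.1.comp hw.1 hwd, ?_, ?_⟩, v, ?_⟩
  · rw [natDegree_comp, hu.2.1, hw.2.1, mul_assoc, Nat.div_mul_cancel (Nat.gcd_dvd_right _ _),
      Nat.lcm, Nat.div_mul_right_comm (Nat.gcd_dvd_left _ _)]
  · rw [eval_comp, hw.2.2, hu.2.2]
  · rw [← comp_assoc, ← hv, hf']

end RightDegrees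

/-! ### Decompositions with prescribed degrees -/

section Decomposables

variable {F : Type*} [Field F]

theorem compList_cons (g : F[X]) (gs : List F[X]) :
    compList (g :: gs) = g.comp (compList gs) := rfl

theorem natDegree_compList (gs : List F[X]) :
    (compList gs).natDegree = (gs.map natDegree).prod := by
  induction gs with
  | nil => simp [compList]
  | cons g gs ih => rw [compList_cons, natDegree_comp, ih, List.map_cons, List.prod_cons]

theorem X_mem_monicOriginal : (X : F[X]) ∈ monicOriginal F 1 :=
  ⟨monic_X, natDegree_X, eval_X⟩

theorem mem_decomposables_cons_iff {a n : ℕ} (hn : n ≠ 0) {d : List ℕ} (hd : d.prod = n)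
    {f : F[X]} (hf : f ∈ monicOriginal F (a * n)) :
    f ∈ decomposables F (a * n) (a :: d) ↔ ∃ h ∈ decomposables F n d, ∃ g : F[X], f = g.comp h := by
  constructor
  · rintro ⟨-, _ | ⟨g, gs⟩, hg, hfg⟩
    · simp at hg
    rw [List.map_cons, List.cons.injEq] at hg
    rw [compList_cons] at hfg
    -- The affine correction that makes the tail monic and original is absorbed by the first
    -- component of the tail. An empty tail has none, but then it is already `X`.
    rcases gs with _ | ⟨g', gs⟩
    · obtain rfl : d = [] := hg.2.symm
      rw [List.prod_nil] at hd
      subst hd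
      exact ⟨X, ⟨X_mem_monicOriginal, [], rfl, rfl⟩, g, hfg⟩
    · set h := compList (g' :: gs) with hh
      have hdeg : h.natDegree = n := by rw [hh, natDegree_compList, hg.2, hd]
      have h0 : h ≠ 0 := by rintro h0; rw [h0, natDegree_zero] at hdeg; exact hn hdeg.symm
      refine ⟨(normalizer h).comp h, ⟨?_, (normalizer h).comp g' :: gs, ?_, ?_⟩,
        g.comp (C h.leadingCoeff * X + C (h.eval 0)), ?_⟩
      · have := normalizer_comp_mem (p := h) (hdeg.trans_ne hn)
        rwa [hdeg] at this
      · rw [← hg.2, List.map_cons, List.map_cons, natDegree_comp, natDegree_normalizer h0, one_mul]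
      · rw [hh, compList_cons, compList_cons, comp_assoc]
      · rw [comp_assoc, comp_normalizer_comp h0, hfg]
  · rintro ⟨h, ⟨hh, gs, hgs, rfl⟩, g, rfl⟩
    refine ⟨hf, g :: gs, ?_, rfl⟩
    have h1 := hf.2.1
    rw [natDegree_comp, hh.2.1] at h1
    rw [List.map_cons, hgs, Nat.eq_of_mul_eq_mul_right (Nat.pos_of_ne_zero hn) h1]

/-- Right components whose degrees divide one another are nested (`mem_rightDegrees_of_dvd`), so
components of the suffix degrees assemble into one decomposition. -/
theorem mem_decomposables_iff {n : ℕ} (hn : (n : F) ≠ 0) {d : List ℕ} (hd : d.prod = n) {f : F[X]}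
    (hf : f ∈ monicOriginal F n) :
    f ∈ decomposables F n d ↔ ∀ i, (d.drop i).prod ∈ rightDegrees f := by
  induction d generalizing n f with
  | nil =>
    obtain rfl : 1 = n := hd
    have hX : f = X := by
      have h1 := hf.1.eq_X_add_C hf.2.1
      have h2 := hf.2.2
      rw [← coeff_zero_eq_eval_zero] at h2
      rw [h1, h2, C_0, add_zero]
    refine ⟨fun _ i => ?_, fun _ => ⟨hf, [], rfl, hX⟩⟩
    rw [List.drop_nil, List.prod_nil]
    exact ⟨X, X_mem_monicOriginal, f, by simp⟩
  | cons a d ih =>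
    rw [List.prod_cons] at hd
    subst hd
    have hn' : (d.prod : F) ≠ 0 := natCast_ne_zero_of_dvd hn (Dvd.intro_left _ rfl)
    have hfn : (f.natDegree : F) ≠ 0 := by rwa [hf.2.1]
    rw [mem_decomposables_cons_iff (fun h => hn' (by simp [h])) rfl hf]
    constructor
    · rintro ⟨h, hh, g, rfl⟩ i
      rcases i with _ | i
      · rw [List.drop_zero, List.prod_cons]
        exact ⟨_, hf, X, by simp⟩
      · exact mem_rightDegrees_comp ((ih hn' rfl hh.1).1 hh i)
    · intro h
      obtain ⟨k, hk, g, hg⟩ := h 1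
      refine ⟨k, (ih hn' rfl hk).2 fun i => ?_, g, hg⟩
      refine mem_rightDegrees_of_dvd hf.1 hfn hk hg ?_ (h (i + 1))
      rw [List.drop_succ_cons, List.drop_zero]
      conv_rhs => rw [← List.take_append_drop i d, List.prod_append]
      exact Dvd.intro_left _ rfl

/-- Complementation `k ↦ n / k` reverses divisibility and so exchanges gcd and lcm. -/
theorem gcd_mul_lcm_of_mul_eq {k₁ k₂ r₁ r₂ n : ℕ} (hn : n ≠ 0) (h₁ : k₁ * r₁ = n)
    (h₂ : k₂ * r₂ = n) : Nat.gcd k₁ k₂ * Nat.lcm r₁ r₂ = n := by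
  have hr : r₁ ≠ 0 := by rintro rfl; exact hn (by simp [← h₁])
  apply Nat.eq_of_mul_eq_mul_left (Nat.gcd_pos_of_pos_left r₂ (Nat.pos_of_ne_zero hr))
  calc Nat.gcd r₁ r₂ * (Nat.gcd k₁ k₂ * Nat.lcm r₁ r₂)
      = Nat.gcd k₁ k₂ * (Nat.gcd r₁ r₂ * Nat.lcm r₁ r₂) := by ring
    _ = Nat.gcd (k₁ * (r₁ * r₂)) (k₂ * (r₁ * r₂)) := by rw [Nat.gcd_mul_lcm, Nat.gcd_mul_right]
    _ = Nat.gcd (n * r₂) (n * r₁) := by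
        rw [← mul_assoc, h₁, mul_left_comm, h₂, mul_comm r₁ n]
    _ = Nat.gcd r₁ r₂ * n := by rw [Nat.gcd_mul_left, Nat.gcd_comm, mul_comm]

theorem mem_decomposables_iff_prefixProds {n : ℕ} (hn : (n : F) ≠ 0) {d : List ℕ} (hd : d.prod = n)
    {f : F[X]} (hf : f ∈ monicOriginal F n) :
    f ∈ decomposables F n d ↔ ∀ k ∈ prefixProds d, ∃ r ∈ rightDegrees f, k * r = n := by
  have hn0 : n ≠ 0 := by rintro rfl; simp at hn
  rw [mem_decomposables_iff hn hd hf]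
  have hmul : ∀ i, (d.take i).prod * (d.drop i).prod = n := fun i => by
    rw [← List.prod_append, List.take_append_drop, hd]
  constructor
  · rintro h _ ⟨i, rfl⟩
    exact ⟨_, h i, hmul i⟩
  · intro h i
    obtain ⟨r, hr, hri⟩ := h _ ⟨i, rfl⟩
    have := Nat.eq_of_mul_eq_mul_left
      (Nat.pos_of_ne_zero (left_ne_zero_of_mul (hri.trans_ne hn0))) (hri.trans (hmul i).symm)
    rwa [← this]

/-- The complement of `lcm(Dᵢ, gcd(Dᵢ₊₁, Eⱼ))` is the gcd of one complement with the lcm of two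
others, all of them degrees of right components. -/
theorem mem_decomposables_refine_fst {n : ℕ} (hn : (n : F) ≠ 0) {d e : List ℕ}
    (hd : IsOrderedFactorization n d) (he : IsOrderedFactorization n e) {f : F[X]}
    (hfd : f ∈ decomposables F n d) (hfe : f ∈ decomposables F n e) :
    f ∈ decomposables F n (refine d e).1 := by
  have hf := hfd.1
  have hn0 : n ≠ 0 := by rintro rfl; simp at hn
  have hfn : (f.natDegree : F) ≠ 0 := by rwa [hf.2.1]
  rw [mem_decomposables_iff_prefixProds hn
    (hd.refine_fst (Nat.pos_of_ne_zero hn0) he).1 hf]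
  rw [mem_decomposables_iff_prefixProds hn hd.1 hf] at hfd
  rw [mem_decomposables_iff_prefixProds hn he.1 hf] at hfe
  intro k hk
  obtain ⟨i, j, rfl⟩ := (mem_prefixProds_refine_fst hd he).1 hk
  obtain ⟨r₁, hr₁, h₁⟩ := hfd _ ⟨i, rfl⟩
  obtain ⟨r₂, hr₂, h₂⟩ := hfd _ ⟨i + 1, rfl⟩
  obtain ⟨r₃, hr₃, h₃⟩ := hfe _ ⟨j, rfl⟩
  have h₄ := gcd_mul_lcm_of_mul_eq hn0 h₂ h₃
  refine ⟨_, gcd_mem_rightDegrees hf.1 hfn hr₁ (lcm_mem_rightDegrees hf.1 hfn hr₂ hr₃), ?_⟩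
  -- Exchanges the roles of divisors and complements, so that the same duality turns the outer lcm
  -- into a gcd.
  rw [mul_comm] at h₁ h₄ ⊢
  exact gcd_mul_lcm_of_mul_eq hn0 h₁ h₄

theorem mem_decomposables_of_refine_fst {n : ℕ} (hn : (n : F) ≠ 0) {d e : List ℕ}
    (hd : IsOrderedFactorization n d) (he : IsOrderedFactorization n e) {f : F[X]}
    (h : f ∈ decomposables F n (refine d e).1) : f ∈ decomposables F n d := by
  have hf := h.1
  have hn0 : n ≠ 0 := by rintro rfl; simp at hn
  rw [mem_decomposables_iff_prefixProds hn
    (hd.refine_fst (Nat.pos_of_ne_zero hn0) he).1 hf] at h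
  rw [mem_decomposables_iff_prefixProds hn hd.1 hf]
  rintro _ ⟨i, rfl⟩
  exact h _ ((mem_prefixProds_refine_fst hd he).2 ⟨i, 0, by simp⟩)

theorem mem_decomposables_refine_iff {n : ℕ} (hF : ¬ ringChar F ∣ n) {d e : List ℕ}
    (hd : IsOrderedFactorization n d) (he : IsOrderedFactorization n e) {f : F[X]} :
    f ∈ decomposables F n (refine d e).1 ∧ f ∈ decomposables F n (refine d e).2 ↔
      f ∈ decomposables F n d ∧ f ∈ decomposables F n e := by
  have hn : (n : F) ≠ 0 := fun h => hF ((ringChar.spec F n).1 h)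
  rw [refine_snd hd he]
  constructor
  · rintro ⟨h1, h2⟩
    exact ⟨mem_decomposables_of_refine_fst hn hd he h1, mem_decomposables_of_refine_fst hn he hd h2⟩
  · rintro ⟨h1, h2⟩
    exact ⟨mem_decomposables_refine_fst hn hd he h1 h2, mem_decomposables_refine_fst hn he hd h2 h1⟩

end Decomposables

end TameCollisions

namespace TameCollisions

/-! ### Scheduling the calls -/

universe u

/-- The calls for the pairs of positions `(0, 1), …, (0, m)`. -/
def sweep (m : ℕ) : List (ℕ × ℕ) := (List.range m).map fun j => (0, j + 1)

theorem computable_sweep_append : Computable fun c => sweep c ++ sweep c := by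
  have h : Primrec sweep :=
    Primrec.list_map Primrec.list_range
      ((Primrec.pair (Primrec.const 0) (Primrec.succ.comp Primrec.snd)).to₂)
  exact (Primrec.list_append.comp h h).to_comp

/-- `t` is a sequence of as many ordered factorizations as `s`, with the same collisions. -/
structure IsReachable (n : ℕ) (s t : List (List ℕ)) : Prop where
  length_eq : t.length = s.length
  isOrderedFactorization : ∀ d ∈ t, IsOrderedFactorization n d
  mem_iff : ∀ (F : Type u) [Field F], ¬ ringChar F ∣ n → ∀ f : Polynomial F,
    (∀ d ∈ t, f ∈ decomposables F n d) ↔ ∀ d ∈ s, f ∈ decomposables F n d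

theorem callAt_eq {s : List (List ℕ)} {j : ℕ} (hj : j + 1 < s.length) :
    callAt s (0, j + 1) = (s.set 0 (refine (s[0]'(by omega)) s[j + 1]).1).set (j + 1)
      (refine (s[0]'(by omega)) s[j + 1]).2 := by
  have h0 : 0 < s.length := by omega
  simp [callAt, hj, h0]

theorem callAt_of_length_le {s : List (List ℕ)} {j : ℕ} (hj : s.length ≤ j + 1) :
    callAt s (0, j + 1) = s := by
  unfold callAt
  rw [List.getElem?_eq_none hj]
  split <;> simp_all

theorem callAt_length (s : List (List ℕ)) (j : ℕ) : (callAt s (0, j + 1)).length = s.length := by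
  by_cases hj : j + 1 < s.length
  · simp [callAt_eq hj]
  · rw [callAt_of_length_le (by omega)]

theorem levelRel_callAt {n : ℕ} (hn : 0 < n) {s : List (List ℕ)}
    (hs : ∀ d ∈ s, IsOrderedFactorization n d) {j : ℕ} (hj : j + 1 < s.length)
    {k : ℕ} (hk : k < s.length) :
    levelRel n ((callAt s (0, j + 1))[k]'(by rwa [callAt_length])) =
      if k = 0 ∨ k = j + 1 then
        levelRel n (s[0]'(by omega)) ∩ levelRel n s[j + 1]
      else levelRel n s[k] := by
  have h0 := hs (s[0]'(by omega)) (List.getElem_mem _)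
  have h1 := hs s[j + 1] (List.getElem_mem _)
  simp only [callAt_eq hj, List.getElem_set]
  simp only [refine_snd h0 h1]
  split_ifs with h2 h3 h4 h5 h6
  · rw [levelRel_refine_fst hn h1 h0, Set.inter_comm]
  · omega
  · rw [levelRel_refine_fst hn h0 h1]
  · omega
  · omega
  · rfl

theorem forall_mem_iff_getElem {s : List (List ℕ)} {P : List ℕ → Prop} :
    (∀ d ∈ s, P d) ↔ ∀ k (hk : k < s.length), P s[k] :=
  ⟨fun h _ _ => h _ (List.getElem_mem _), fun h d hd => by
    obtain ⟨k, hk, rfl⟩ := List.getElem_of_mem hd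
    exact h k hk⟩

theorem isReachable_callAt {n : ℕ} (hn : 0 < n) {s t : List (List ℕ)}
    (h : IsReachable.{u} n s t) (j : ℕ) : IsReachable.{u} n s (callAt t (0, j + 1)) := by
  by_cases hj : j + 1 < t.length
  · have h0 := h.isOrderedFactorization (t[0]'(by omega)) (List.getElem_mem _)
    have h1 := h.isOrderedFactorization t[j + 1] (List.getElem_mem _)
    refine ⟨(callAt_length _ _).trans h.length_eq, ?_, fun F _ hF f => ?_⟩
    · rw [forall_mem_iff_getElem]
      intro k hk
      rw [callAt_length] at hk
      simp only [callAt_eq hj, List.getElem_set]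
      simp only [refine_snd h0 h1]
      split_ifs
      · exact h1.refine_fst hn h0
      · exact h0.refine_fst hn h1
      · exact h.isOrderedFactorization _ (List.getElem_mem _)
    · rw [← h.mem_iff F hF f, forall_mem_iff_getElem, forall_mem_iff_getElem]
      have key := mem_decomposables_refine_iff hF h0 h1 (f := f)
      simp only [callAt_eq hj, List.getElem_set, List.length_set]
      constructor
      · intro hc
        have hc0 := hc 0 (by omega)
        have hcj := hc (j + 1) hj
        simp only [if_true, Nat.add_eq_zero_iff, one_ne_zero, and_false, if_false] at hc0 hcj
        have h2 := key.1 ⟨hc0, hcj⟩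
        intro k hk
        by_cases hk0 : 0 = k
        · subst hk0; exact h2.1
        by_cases hkj : j + 1 = k
        · subst hkj; exact h2.2
        have := hc k hk
        rwa [if_neg hkj, if_neg hk0] at this
      · intro hc k hk
        have h2 := key.2 ⟨hc 0 (by omega), hc (j + 1) hj⟩
        split_ifs
        exacts [h2.2, h2.1, hc k hk]
  · rwa [callAt_of_length_le (by omega)]

theorem runCalls_sweep_succ (m : ℕ) (s : List (List ℕ)) :
    runCalls (sweep (m + 1)) s = callAt (runCalls (sweep m) s) (0, m + 1) := by
  simp [runCalls, sweep, List.range_succ]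

theorem isReachable_sweep {n : ℕ} (hn : 0 < n) {s t : List (List ℕ)}
    (h : IsReachable.{u} n s t) (m : ℕ) : IsReachable.{u} n s (runCalls (sweep m) t) := by
  induction m with
  | zero => exact h
  | succ m ih =>
    rw [runCalls_sweep_succ]
    exact isReachable_callAt hn ih m

/-- The relation at position `0` only shrinks, and each visited position held the same relation
right after its call. -/
theorem levelRel_first_sweep {n : ℕ} (hn : 0 < n) {s t : List (List ℕ)}
    (h : IsReachable.{u} n s t) (m : ℕ) :
    ∀ k (h0 : 0 < (runCalls (sweep m) t).length) (hk : k < (runCalls (sweep m) t).length), k ≤ m →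
      levelRel n (runCalls (sweep m) t)[0] ⊆ levelRel n (runCalls (sweep m) t)[k] := by
  induction m with
  | zero =>
    intro k h0 hk hkm
    obtain rfl : k = 0 := by omega
    exact subset_rfl
  | succ m ih =>
    have hr := isReachable_sweep hn h m
    intro k h0 hk hkm
    simp only [runCalls_sweep_succ] at h0 hk ⊢
    by_cases hj : m + 1 < (runCalls (sweep m) t).length
    · rw [callAt_length] at h0 hk
      rw [levelRel_callAt hn hr.isOrderedFactorization hj h0,
        levelRel_callAt hn hr.isOrderedFactorization hj hk, if_pos (Or.inl rfl)]
      split_ifs with hc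
      · exact subset_rfl
      · exact Set.inter_subset_left.trans (ih k h0 hk (by omega))
    · simp only [callAt_of_length_le (not_lt.1 hj)] at h0 hk ⊢
      exact ih k h0 hk (by omega)

/-- The relation at position `0` is already contained in all others, so intersecting leaves it
unchanged and copies it to the visited position. -/
theorem levelRel_second_sweep {n : ℕ} (hn : 0 < n) {s t : List (List ℕ)}
    (h : IsReachable.{u} n s t)
    (h1 : ∀ k (h0 : 0 < t.length) (hk : k < t.length), levelRel n t[0] ⊆ levelRel n t[k]) (m : ℕ) :
    ∀ k (h0 : 0 < (runCalls (sweep m) t).length) (hk : k < (runCalls (sweep m) t).length),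
      levelRel n (runCalls (sweep m) t)[0] ⊆ levelRel n (runCalls (sweep m) t)[k] ∧
      (k ≤ m → levelRel n (runCalls (sweep m) t)[0] = levelRel n (runCalls (sweep m) t)[k]) := by
  induction m with
  | zero =>
    intro k h0 hk
    refine ⟨h1 k h0 hk, fun hkm => ?_⟩
    obtain rfl : k = 0 := by omega
    rfl
  | succ m ih =>
    have hr := isReachable_sweep hn h m
    intro k h0 hk
    simp only [runCalls_sweep_succ] at h0 hk ⊢
    by_cases hj : m + 1 < (runCalls (sweep m) t).length
    · rw [callAt_length] at h0 hk
      rw [levelRel_callAt hn hr.isOrderedFactorization hj h0,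
        levelRel_callAt hn hr.isOrderedFactorization hj hk, if_pos (Or.inl rfl),
        Set.inter_eq_left.2 (ih (m + 1) h0 hj).1]
      split_ifs with hc
      · exact ⟨subset_rfl, fun _ => rfl⟩
      · exact ⟨(ih k h0 hk).1, fun hkm => (ih k h0 hk).2 (by omega)⟩
    · simp only [callAt_of_length_le (not_lt.1 hj)] at h0 hk ⊢
      exact ⟨(ih k h0 hk).1, fun _ => (ih k h0 hk).2 (by omega)⟩

theorem levelRel_two_sweeps {n : ℕ} (hn : 0 < n) {s : List (List ℕ)}
    (h : IsReachable.{u} n s s) {d e : List ℕ}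
    (hd : d ∈ runCalls (sweep s.length ++ sweep s.length) s)
    (he : e ∈ runCalls (sweep s.length ++ sweep s.length) s) : levelRel n d = levelRel n e := by
  have happ : runCalls (sweep s.length ++ sweep s.length) s =
      runCalls (sweep s.length) (runCalls (sweep s.length) s) := by
    simp [runCalls, List.foldl_append]
  rw [happ] at hd he
  have hr := isReachable_sweep hn h s.length
  have hl := hr.length_eq
  have hl2 := (isReachable_sweep hn hr s.length).length_eq
  have key := levelRel_second_sweep hn hr (fun k h0 hk =>
    levelRel_first_sweep hn h s.length k h0 hk (by omega)) s.length
  obtain ⟨i, hi, rfl⟩ := List.getElem_of_mem hd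
  obtain ⟨j, hj, rfl⟩ := List.getElem_of_mem he
  rw [← (key i (by omega) hi).2 (by omega), ← (key j (by omega) hj).2 (by omega)]

end TameCollisions

theorem proposition3p11 :
    ∃ (C : ℕ) (calls : ℕ → List (ℕ × ℕ)),
      Computable calls ∧ (∀ c : ℕ, (calls c).length ≤ C * c ^ 2) ∧
      ∀ n : ℕ, 0 < n → ∀ D : Finset (List ℕ),
        (∀ d ∈ D, TameCollisions.IsOrderedFactorization n d) →
        ∀ s : List (List ℕ), s.Nodup → s.toFinset = D →
          ∃ Dstar : Finset (List ℕ),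
            Dstar = (TameCollisions.runCalls (calls D.card) s).toFinset ∧
            Dstar.card ≤ D.card ∧
            (∀ d ∈ Dstar, TameCollisions.IsOrderedFactorization n d) ∧
            (∀ d ∈ Dstar, ∀ e ∈ Dstar, TameCollisions.AreAssociated d e) ∧
            ∀ (F : Type*) [Field F], ¬ ringChar F ∣ n →
              TameCollisions.collisions F n Dstar = TameCollisions.collisions F n D := by
  refine ⟨2, fun c => TameCollisions.sweep c ++ TameCollisions.sweep c,
    TameCollisions.computable_sweep_append, fun c => ?_, ?_⟩
  · simp only [TameCollisions.sweep, List.length_append, List.length_map, List.length_range]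
    -- There are `2 * c` calls, and `c ≤ c ^ 2`. The last call of each sweep addresses position `c`,
    -- which does not exist, and changes nothing.
    nlinarith [Nat.le_self_pow two_ne_zero c]
  rintro n hn D hD s hs rfl
  have hs0 : TameCollisions.IsReachable n s s :=
    ⟨rfl, fun d hd => hD d (List.mem_toFinset.2 hd), fun _ _ _ _ => Iff.rfl⟩
  have hr : TameCollisions.IsReachable n s
      (TameCollisions.runCalls (TameCollisions.sweep s.length ++ TameCollisions.sweep s.length) s) := by
    have := TameCollisions.isReachable_sweep hn
      (TameCollisions.isReachable_sweep hn hs0 s.length) s.length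
    rwa [TameCollisions.runCalls, TameCollisions.runCalls, ← List.foldl_append] at this
  have hcard : s.toFinset.card = s.length := List.toFinset_card_of_nodup hs
  refine ⟨_, rfl, ?_, ?_, ?_, ?_⟩
  · rw [hcard]
    exact (List.toFinset_card_le _).trans hr.length_eq.le
  · intro d hd
    rw [hcard, List.mem_toFinset] at hd
    exact hr.isOrderedFactorization d hd
  · intro d hd e he
    rw [hcard, List.mem_toFinset] at hd he
    exact TameCollisions.areAssociated_of_levelRel_eq hn (hr.isOrderedFactorization d hd)
      (hr.isOrderedFactorization e he) (TameCollisions.levelRel_two_sweeps hn hs0 hd he)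
  · intro F _ hF
    ext f
    have := hr.mem_iff F hF f
    simp only [TameCollisions.collisions, hcard, List.mem_toFinset, Set.mem_ofPred_eq]
    rw [this]
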